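/- Let $H$ be a compact Hopf $*$-algebra over $\mathbb C$: a cosemisimple Hopf algebra (every finite-dimensional right comodule is a direct sum of simple ones) with a conjugate-linear involutive anti-automorphism $*$, such that every simple right comodule $V$, $v\mapsto v_0\otimes v_1\in V\otimes H$, carries a scalar product with $\langle v_0,w\rangle S(v_1)=\langle v,w_0\rangle w_1^*$ for all $v,w\in V$. Let $\int:H\to\mathbb C$ be the left integral, $\int(x)\,1=x_1\int(x_2)$, normalized by $\int(1)=1$. Let $\check H$ be the vector space $H$ with the convolution product $g*f=\int(fS(g_1))\,g_2$ and the involution $f^\star=S(f^*)$. Each simple comodule $V_\lambda$ is a simple $\check H$-module by $\pi_\lambda(h)v=v_0\int(v_1S(h))$; equip it with a scalar product for which it is a $\star$-module, i.e. $\langle\pi_\lambda(h)v,w\rangle=\langle v,\pi_\lambda(h^\star)w\rangle$. Let $H_{C^*}$ be the completion of $\check H$ with respect to $\|f\|_{C^*}=\sup_\lambda\|\pi_\lambda(f)\|$, where $\lambda$ runs over the isomorphism classes of simple comodules (equivalently, over all simple comodules with such a scalar product). An irreducible unitary representation of $\check H$ or $H_{C^*}$ is a nonzero $*$-homomorphism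 to the bounded operators on a complex Hilbert space without nontrivial closed invariant subspaces; for $\check H$ the involution is $\star$. Then $\|\cdot\|_{C^*}$ is a finite norm on $\check H$, so that $\check H$ embeds as a dense $*$-subalgebra of the $C^*$-algebra $H_{C^*}$; all irreducible unitary representations of $H_{C^*}$ and of $\check H$ are finite-dimensional; restriction to $\check H$ induces a bijection between the unitary equivalence classes of irreducible unitary representations of $H_{C^*}$ and those of $\check H$; and $H_{C^*}$ is a $C^*$-algebra of type I, i.e. every representation of it on a Hilbert space generates a von Neumann algebra of type I. -/

import Mathlib

open scoped TensorProduct ENNReal ComplexConjugate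

universe u w

noncomputable section

/-! ### Right comodules over a Hopf algebra -/

section Comodules

variable {H : Type u} [Ring H] [HopfAlgebra ℂ H]
variable {V : Type*} [AddCommGroup V] [Module ℂ V]

/-- `δ : V → V ⊗ H` is a right coaction: `(id ⊗ ε) δ = id` and `(δ ⊗ id) δ = (id ⊗ Δ) δ`. -/
structure IsRightCoaction (δ : V →ₗ[ℂ] V ⊗[ℂ] H) : Prop where
  counit : ∀ v, TensorProduct.rid ℂ V ((Coalgebra.counit (R := ℂ) (A := H)).lTensor V (δ v)) = v
  coassoc : ∀ v, TensorProduct.assoc ℂ V H H (δ.rTensor H (δ v)) =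
    (Coalgebra.comul (R := ℂ) (A := H)).lTensor V (δ v)

/-- `W` is a subcomodule: `δ W ⊆ W ⊗ H`. -/
def IsSubcomodule (δ : V →ₗ[ℂ] V ⊗[ℂ] H) (W : Submodule ℂ V) : Prop :=
  ∀ v ∈ W, δ v ∈ LinearMap.range (W.subtype.rTensor H)

/-- `W` is a simple subcomodule: it is nonzero, and its only subcomodules are `0` and `W`. -/
structure IsSimpleSubcomodule (δ : V →ₗ[ℂ] V ⊗[ℂ] H) (W : Submodule ℂ V) : Prop where
  isSub : IsSubcomodule δ W
  ne_bot : W ≠ ⊥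
  eq_or : ∀ W' ≤ W, IsSubcomodule δ W' → W' = ⊥ ∨ W' = W

/-- The comodule `(V, δ)` is simple. -/
def IsSimpleComodule (δ : V →ₗ[ℂ] V ⊗[ℂ] H) : Prop :=
  IsSimpleSubcomodule δ ⊤

variable (H) in
/-- Every finite-dimensional comodule is a direct sum of simple comodules. -/
def IsCosemisimple : Prop :=
  ∀ (V : Type) [AddCommGroup V] [Module ℂ V] [FiniteDimensional ℂ V]
    (δ : V →ₗ[ℂ] V ⊗[ℂ] H), IsRightCoaction δ →
    ∃ (m : ℕ) (W : Fin m → Submodule ℂ V),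
      DirectSum.IsInternal W ∧ ∀ i, IsSimpleSubcomodule δ (W i)

end Comodules

/-! ### Compact Hopf `*`-algebras -/

section Compact

variable {V : Type*} [AddCommGroup V] [Module ℂ V]

/-- `B` is a scalar product, with the convention `B w v = ⟨v, w⟩`
(linear in `v`, conjugate-linear in `w`). -/
structure IsScalarProduct (B : V →ₗ⋆[ℂ] V →ₗ[ℂ] ℂ) : Prop where
  conj_symm : ∀ v w, conj (B v w) = B w v
  pos : ∀ v, v ≠ 0 → 0 < (B v v).re

variable {H : Type u} [Ring H] [HopfAlgebra ℂ H]

/-- The linear map `V ⊗ H → H`, `v ⊗ h ↦ f v • h`, for a linear form `f` on `V`. -/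
def slice (f : V →ₗ[ℂ] ℂ) : V ⊗[ℂ] H →ₗ[ℂ] H :=
  (TensorProduct.lid ℂ H).toLinearMap ∘ₗ f.rTensor H

variable [StarRing H]

/-- The scalar product `B` makes the comodule `(V, δ)` unitary:
`⟨v₀, w⟩ S(v₁) = ⟨v, w₀⟩ w₁*` for all `v, w`. The right-hand side is `(⟨w₀, v⟩ w₁)*`. -/
def IsUnitaryFor (δ : V →ₗ[ℂ] V ⊗[ℂ] H) (B : V →ₗ⋆[ℂ] V →ₗ[ℂ] ℂ) : Prop :=
  ∀ v w, HopfAlgebra.antipode ℂ (slice (B w) (δ v)) = star (slice (B v) (δ w))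

variable (H) in
/-- A compact Hopf `*`-algebra (CQG algebra): a cosemisimple Hopf algebra over `ℂ` with an
involutive conjugate-linear anti-automorphism `*`, every simple comodule of which is
unitarizable. (Simple comodules are finite-dimensional.) -/
structure IsCompactHopfStarAlgebra : Prop where
  cosemisimple : IsCosemisimple H
  unitarizable : ∀ (V : Type) [AddCommGroup V] [Module ℂ V] [FiniteDimensional ℂ V]
    (δ : V →ₗ[ℂ] V ⊗[ℂ] H), IsRightCoaction δ → IsSimpleComodule δ →
    ∃ B : V →ₗ⋆[ℂ] V →ₗ[ℂ] ℂ, IsScalarProduct B ∧ IsUnitaryFor δ B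

end Compact

/-! ### The integral and the convolution algebra -/

section Convolution

variable {H : Type u} [Ring H] [HopfAlgebra ℂ H]

/-- `φ` is the left integral on `H` with `∫ 1 = 1`: `(∫ x) 1 = x₁ ∫ x₂`. -/
structure IsNormalizedIntegral (φ : H →ₗ[ℂ] ℂ) : Prop where
  left_inv : ∀ x : H, TensorProduct.rid ℂ H (φ.lTensor H (Coalgebra.comul (R := ℂ) x)) = φ x • 1
  map_one : φ 1 = 1

/-- The linear form `a ↦ ∫ f S(a)`. -/
def integralMulAntipode (φ : H →ₗ[ℂ] ℂ) (f : H) : H →ₗ[ℂ] ℂ :=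
  φ ∘ₗ LinearMap.mulLeft ℂ f ∘ₗ HopfAlgebra.antipode ℂ

/-- The convolution product `g * f = ∫ (f S(g₁)) g₂`. -/
def convMul (φ : H →ₗ[ℂ] ℂ) (g f : H) : H :=
  slice (integralMulAntipode φ f) (Coalgebra.comul (R := ℂ) g)

/-- The linear form `a ↦ ∫ a S(h)`. -/
def integralAgainst (φ : H →ₗ[ℂ] ℂ) (h : H) : H →ₗ[ℂ] ℂ :=
  φ ∘ₗ LinearMap.mulRight ℂ (HopfAlgebra.antipode ℂ h)

/-- The vector space `H` with the convolution product given by the integral `φ`. -/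
@[nolint unusedArguments]
def ConvAlg (_φ : H →ₗ[ℂ] ℂ) : Type u := H

variable (φ : H →ₗ[ℂ] ℂ)

instance : AddCommGroup (ConvAlg φ) := inferInstanceAs (AddCommGroup H)

instance : Module ℂ (ConvAlg φ) := inferInstanceAs (Module ℂ H)

instance : Mul (ConvAlg φ) := ⟨fun g f => convMul (H := H) φ g f⟩

theorem convMul_add_left (a b c : H) : convMul φ (a + b) c = convMul φ a c + convMul φ b c := by
  simp [convMul]

theorem convMul_add_right (a b c : H) : convMul φ a (b + c) = convMul φ a b + convMul φ a c := by
  have h : integralMulAntipode φ (b + c) = integralMulAntipode φ b + integralMulAntipode φ c := by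
    ext x; simp [integralMulAntipode, add_mul]
  simp [convMul, h, slice, LinearMap.rTensor_add]

theorem convMul_zero_left (a : H) : convMul φ 0 a = 0 := by
  simp [convMul]

theorem convMul_zero_right (a : H) : convMul φ a 0 = 0 := by
  have h : integralMulAntipode φ 0 = 0 := by
    ext x; simp [integralMulAntipode]
  simp [convMul, h, slice]

instance : NonUnitalNonAssocRing (ConvAlg φ) where
  left_distrib a b c := convMul_add_right φ a b c
  right_distrib a b c := convMul_add_left φ a b c
  zero_mul a := convMul_zero_left φ a
  mul_zero a := convMul_zero_right φ a

/-- The involution `f ↦ S(f*)` on the convolution algebra. -/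
instance [StarRing H] : Star (ConvAlg φ) := ⟨fun f => HopfAlgebra.antipode ℂ (A := H) (star (R := H) f)⟩

/-- The action of the convolution algebra on a comodule: `h * v = v₀ ∫ v₁ S(h)`. -/
def convAct {V : Type*} [AddCommGroup V] [Module ℂ V] (δ : V →ₗ[ℂ] V ⊗[ℂ] H)
    (h : ConvAlg φ) : V →ₗ[ℂ] V :=
  (TensorProduct.rid ℂ V).toLinearMap ∘ₗ (integralAgainst φ h).lTensor V ∘ₗ δ

end Convolution

/-! ### The `C*`-algebra of a compact Hopf `*`-algebra -/

section CStar

variable {H : Type u} [Ring H] [HopfAlgebra ℂ H] [StarRing H] (φ : H →ₗ[ℂ] ℂ)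

/-- A simple comodule, as a finite-dimensional Hilbert space `ℂᵈ` on which the convolution algebra
acts by a `⋆`-representation. Every simple comodule is isomorphic to one of these, for a
scalar product that is unique up to a positive factor; hence isomorphic simple comodules lead
to unitarily equivalent modules, and a supremum over all members of this type is a supremum over
the isomorphism classes of simple comodules. -/
structure SimpleStarModule where
  dim : ℕ
  coact : EuclideanSpace ℂ (Fin dim) →ₗ[ℂ] EuclideanSpace ℂ (Fin dim) ⊗[ℂ] H
  isCoaction : IsRightCoaction coact
  isSimple : IsSimpleComodule coact
  isStar : ∀ (h : ConvAlg φ) (v w : EuclideanSpace ℂ (Fin dim)),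
    inner ℂ w (convAct φ coact h v) = inner ℂ (convAct φ coact (star h) w) v

variable {φ} in
/-- The operator by which `f` acts on the simple module `l`. -/
def SimpleStarModule.op (l : SimpleStarModule φ) (f : ConvAlg φ) :
    EuclideanSpace ℂ (Fin l.dim) →L[ℂ] EuclideanSpace ℂ (Fin l.dim) :=
  LinearMap.toContinuousLinearMap (convAct φ l.coact f)

/-- The `C*`-norm `‖f‖ = sup ‖π_λ(f)‖` on the convolution algebra. -/
def cstarNorm (f : ConvAlg φ) : ℝ := ⨆ l : SimpleStarModule φ, ‖l.op f‖

/-- The `C*`-algebra of bounded families of operators on the simple modules. -/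
def BoundedFamilies : Type u :=
  lp (fun l : SimpleStarModule φ =>
    EuclideanSpace ℂ (Fin l.dim) →L[ℂ] EuclideanSpace ℂ (Fin l.dim)) ∞

instance : NonUnitalCStarAlgebra (BoundedFamilies φ) :=
  inferInstanceAs (NonUnitalCStarAlgebra (lp (fun l : SimpleStarModule φ =>
    EuclideanSpace ℂ (Fin l.dim) →L[ℂ] EuclideanSpace ℂ (Fin l.dim)) ∞))

variable {φ} in
/-- The component of a bounded family at `l`. -/
def BoundedFamilies.component (T : BoundedFamilies φ) (l : SimpleStarModule φ) :
    EuclideanSpace ℂ (Fin l.dim) →L[ℂ] EuclideanSpace ℂ (Fin l.dim) :=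
  (show lp (fun l : SimpleStarModule φ =>
    EuclideanSpace ℂ (Fin l.dim) →L[ℂ] EuclideanSpace ℂ (Fin l.dim)) ∞ from T) l

/-- The completion of the convolution algebra for `cstarNorm`, realised as the closed
`*`-subalgebra of the algebra of bounded families generated by the families `(π_λ(f))_λ`. -/
def HCStar : NonUnitalStarSubalgebra ℂ (BoundedFamilies φ) :=
  (NonUnitalStarAlgebra.adjoin ℂ
    {T : BoundedFamilies φ | ∃ f : ConvAlg φ, ∀ l, T.component l = l.op f}).topologicalClosure

instance : IsClosed (HCStar φ : Set (BoundedFamilies φ)) :=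
  NonUnitalStarSubalgebra.isClosed_topologicalClosure _

instance : NonUnitalCStarAlgebra (HCStar φ) :=
  NonUnitalStarSubalgebra.nonUnitalCStarAlgebra (HCStar φ)

end CStar

/-! ### Irreducible unitary representations -/

section Representations

/-- An irreducible unitary representation of a (possibly non-unital) `*`-algebra on a Hilbert
space: a nonzero `*`-homomorphism to the bounded operators without nontrivial closed invariant
subspaces. -/
structure IrredUnitaryRep (A : Type u) [NonUnitalNonAssocSemiring A] [Module ℂ A] [Star A] where
  space : Type w
  [normed : NormedAddCommGroup space]
  [innerProd : InnerProductSpace ℂ space]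
  [complete : CompleteSpace space]
  hom : A →⋆ₙₐ[ℂ] (space →L[ℂ] space)
  ne_zero : ∃ a, hom a ≠ 0
  irreducible : ∀ K : Submodule ℂ space, IsClosed (K : Set space) →
    (∀ a, ∀ v ∈ K, hom a v ∈ K) → K = ⊥ ∨ K = ⊤

attribute [instance] IrredUnitaryRep.normed IrredUnitaryRep.innerProd IrredUnitaryRep.complete

variable (A : Type u) [NonUnitalNonAssocSemiring A] [Module ℂ A] [Star A]

/-- Unitary equivalence. -/
instance IrredUnitaryRep.setoid : Setoid (IrredUnitaryRep.{u, w} A) where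
  r ρ σ := ∃ U : ρ.space ≃ₗᵢ[ℂ] σ.space, ∀ a v, U (ρ.hom a v) = σ.hom a (U v)
  iseqv :=
    { refl := fun ρ => ⟨LinearIsometryEquiv.refl ℂ ρ.space, fun _ _ => rfl⟩
      symm := by
        rintro ρ σ ⟨U, hU⟩
        refine ⟨U.symm, fun a v => ?_⟩
        apply U.injective
        simp [hU]
      trans := by
        rintro ρ σ τ ⟨U, hU⟩ ⟨W, hW⟩
        exact ⟨U.trans W, fun a v => by simp [hU, hW]⟩ }

/-- The set of unitary equivalence classes of irreducible unitary representations. -/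
def IrredClasses : Type _ := Quotient (IrredUnitaryRep.setoid.{u, w} A)

end Representations

/-! ### Type I -/

section TypeI

variable {E : Type w} [NormedAddCommGroup E] [InnerProductSpace ℂ E] [CompleteSpace E]

/-- A von Neumann algebra `M` is of type I if below every nonzero central projection `z` there is
a nonzero abelian projection `p` of `M`, that is, one for which `p M p` is commutative. -/
def IsTypeIVonNeumann (M : VonNeumannAlgebra E) : Prop :=
  ∀ z ∈ M, z ∈ M.commutant → IsStarProjection z → z ≠ 0 →
    ∃ p ∈ M, IsStarProjection p ∧ p ≠ 0 ∧ z * p = p ∧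
      ∀ a ∈ M, ∀ b ∈ M, (p * a * p) * (p * b * p) = (p * b * p) * (p * a * p)

/-- The von Neumann algebra generated by a set of operators (and their adjoints): the
double commutant. -/
def generatedVonNeumann (s : Set (E →L[ℂ] E)) : VonNeumannAlgebra E where
  toStarSubalgebra :=
    StarSubalgebra.centralizer ℂ (StarSubalgebra.centralizer ℂ s : Set (E →L[ℂ] E))
  centralizer_centralizer' := by
    change Set.centralizer (Set.centralizer
      (StarSubalgebra.centralizer ℂ (StarSubalgebra.centralizer ℂ s : Set (E →L[ℂ] E)) :
        Set (E →L[ℂ] E))) =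
      (StarSubalgebra.centralizer ℂ (StarSubalgebra.centralizer ℂ s : Set (E →L[ℂ] E)) :
        Set (E →L[ℂ] E))
    rw [StarSubalgebra.coe_centralizer_centralizer, Set.centralizer_centralizer_centralizer]

/-- A `C*`-algebra is of type I if each of its representations on a Hilbert space generates a
von Neumann algebra of type I. -/
def IsTypeICStar (A : Type u) [NonUnitalCStarAlgebra A] : Prop :=
  ∀ (E : Type w) [NormedAddCommGroup E] [InnerProductSpace ℂ E] [CompleteSpace E]
    (π : A →⋆ₙₐ[ℂ] (E →L[ℂ] E)), IsTypeIVonNeumann (generatedVonNeumann (Set.range π))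

end TypeI

end

/-! Write `∫` for `φ`. The key fact is strong invariance of the integral (`rslice_integralAgainst`):
left convolution by `h` is the action of the linear form `∫(· S(h))` on the right comodule `H`.
Since every element of `H` lies in a finite-dimensional subcomodule, every element of the
convolution algebra lies in a finite-dimensional left ideal `C`. Most of the theorem follows from
this.

Finiteness of the norm: with `h = f⋆ * f`, the nonzero spectrum of `ψ(h)` in any `*`-representation
`ψ` consists of eigenvalues of left multiplication by `h` on a fixed `C`, so `‖ψ(f)‖² = ‖ψ(h)‖` is
bounded independently of `ψ` (`exists_norm_le`). Irreducible representations: `C v` is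
finite-dimensional and invariant, hence the whole space as soon as it is nonzero.

The forms `∫(· S(h))` separate points and are nondegenerate in `h`. They fill the dual of every
finite-dimensional subspace, so an irreducible representation of the convolution algebra comes from
a simple comodule (`exists_simpleStarModule`). It therefore extends to the completion by evaluation
at a component; density gives uniqueness. For faithfulness, a unitary simple comodule is made into a
`⋆`-module by twisting its matrix by `S²`, and the coefficients of these comodules span `H`.

Type I: for a central projection `z` not annihilating the representation `π`, some `z π(C)` is a
nonzero finite-dimensional space stable under left multiplication by `π`. It contains a projection
`p` with `p π(a) p ∈ ℂ p`, and the double commutant then has a commutative corner at `p`. If `z`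
annihilates `π`, then `z` itself serves as `p`. -/

noncomputable section

/-! ### Slices of tensors; comodules as modules over the dual algebra. -/

section Slices

variable {H : Type u} [Ring H] [HopfAlgebra ℂ H]
variable {V : Type*} [AddCommGroup V] [Module ℂ V]
variable {V' : Type*} [AddCommGroup V'] [Module ℂ V']

/-- The linear map `V ⊗ H → V`, `v ⊗ h ↦ g h • v`, for a linear form `g` on `H`. -/
def rslice (g : H →ₗ[ℂ] ℂ) : V ⊗[ℂ] H →ₗ[ℂ] V :=
  (TensorProduct.rid ℂ V).toLinearMap ∘ₗ g.lTensor V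

@[simp]
theorem rslice_tmul (g : H →ₗ[ℂ] ℂ) (v : V) (h : H) : rslice g (v ⊗ₜ[ℂ] h) = g h • v := by
  simp [rslice]

@[simp]
theorem slice_tmul (f : V →ₗ[ℂ] ℂ) (v : V) (h : H) : slice f (v ⊗ₜ[ℂ] h) = f v • h := by
  simp [slice]

theorem rslice_rTensor (g : H →ₗ[ℂ] ℂ) (F : V →ₗ[ℂ] V') (t : V ⊗[ℂ] H) :
    rslice g (F.rTensor H t) = F (rslice g t) := by
  induction t with
  | zero => simp
  | tmul v h => simp
  | add x y hx hy => simp [hx, hy]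

theorem slice_rTensor (f : V' →ₗ[ℂ] ℂ) (F : V →ₗ[ℂ] V') (t : V ⊗[ℂ] H) :
    slice f (F.rTensor H t) = slice (f ∘ₗ F) t := by
  induction t with
  | zero => simp
  | tmul v h => simp
  | add x y hx hy => simp [hx, hy]

theorem map_slice_eq_map_rslice (f : V →ₗ[ℂ] ℂ) (g : H →ₗ[ℂ] ℂ) (t : V ⊗[ℂ] H) :
    g (slice f t) = f (rslice g t) := by
  induction t with
  | zero => simp
  | tmul v h => simp [mul_comm]
  | add x y hx hy => simp [hx, hy]

theorem rslice_add (g g' : H →ₗ[ℂ] ℂ) (t : V ⊗[ℂ] H) :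
    rslice (g + g') t = rslice g t + rslice g' t := by
  simp [rslice, LinearMap.lTensor_add]

theorem rslice_smul (c : ℂ) (g : H →ₗ[ℂ] ℂ) (t : V ⊗[ℂ] H) :
    rslice (c • g) t = c • rslice g t := by
  simp [rslice, LinearMap.lTensor_smul]

theorem equivFinsuppOfBasisRight_eq_rslice {κ : Type*} [DecidableEq κ] (b : Module.Basis κ ℂ H)
    (t : V ⊗[ℂ] H) (i : κ) :
    TensorProduct.equivFinsuppOfBasisRight b t i = rslice (b.coord i) t := by
  induction t with
  | zero => simp
  | tmul v h => simp
  | add x y hx hy => simp [hx, hy]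

theorem tensor_ext_rslice {s t : V ⊗[ℂ] H} (h : ∀ g : H →ₗ[ℂ] ℂ, rslice g s = rslice g t) :
    s = t := by
  classical
  let b := Module.Basis.ofVectorSpace ℂ H
  apply (TensorProduct.equivFinsuppOfBasisRight (M := V) b).injective
  ext i
  rw [equivFinsuppOfBasisRight_eq_rslice, equivFinsuppOfBasisRight_eq_rslice, h]

theorem mem_range_rTensor_subtype_iff (W : Submodule ℂ V) (t : V ⊗[ℂ] H) :
    t ∈ LinearMap.range (W.subtype.rTensor H) ↔ ∀ g : H →ₗ[ℂ] ℂ, rslice g t ∈ W := by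
  classical
  constructor
  · rintro ⟨s, rfl⟩ g
    rw [rslice_rTensor]
    exact (rslice g s).2
  · intro h
    let b := Module.Basis.ofVectorSpace ℂ H
    have ht := (TensorProduct.equivFinsuppOfBasisRight (M := V) b).symm_apply_apply t
    rw [← ht, TensorProduct.equivFinsuppOfBasisRight_symm_apply]
    refine Submodule.sum_mem _ fun i _ => ?_
    dsimp only
    rw [equivFinsuppOfBasisRight_eq_rslice]
    exact ⟨⟨_, h (b.coord i)⟩ ⊗ₜ b i, by simp⟩

theorem isSubcomodule_iff_rslice (δ : V →ₗ[ℂ] V ⊗[ℂ] H) (W : Submodule ℂ V) :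
    IsSubcomodule δ W ↔ ∀ v ∈ W, ∀ g : H →ₗ[ℂ] ℂ, rslice g (δ v) ∈ W := by
  simp only [IsSubcomodule, mem_range_rTensor_subtype_iff]

/-- The product `g * g' = (g ⊗ g') Δ` of linear forms on `H`. -/
def formMul (g g' : H →ₗ[ℂ] ℂ) : H →ₗ[ℂ] ℂ :=
  g' ∘ₗ slice g ∘ₗ Coalgebra.comul

theorem tensor_ext_forms {s t : V ⊗[ℂ] (H ⊗[ℂ] H)}
    (h : ∀ g g' : H →ₗ[ℂ] ℂ, TensorProduct.rid ℂ V ((g' ∘ₗ slice g).lTensor V s) =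
      TensorProduct.rid ℂ V ((g' ∘ₗ slice g).lTensor V t)) : s = t := by
  classical
  let b := Module.Basis.ofVectorSpace ℂ H
  have key : ∀ (x : V ⊗[ℂ] (H ⊗[ℂ] H)) i, TensorProduct.equivFinsuppOfBasisRight
      (M := V) (b.tensorProduct b) x i =
      TensorProduct.rid ℂ V ((b.coord i.2 ∘ₗ slice (b.coord i.1)).lTensor V x) := by
    intro x i
    induction x with
    | zero => simp
    | tmul v y =>
      induction y with
      | zero => simp
      | tmul p q =>
        obtain ⟨i, j⟩ := i
        simp [Module.Basis.tensorProduct_repr_tmul_apply, mul_comm]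
      | add x y hx hy => simp_all [TensorProduct.tmul_add]
    | add x y hx hy => simp [hx, hy]
  apply (TensorProduct.equivFinsuppOfBasisRight (M := V) (b.tensorProduct b)).injective
  ext i
  rw [key, key, h]

/-- Slices separate tensors, so the coaction axioms can be tested on forms: a comodule is a module
over the dual of `H` with product `formMul` and unit the counit. All later comodule arguments use
this dual form. -/
theorem isRightCoaction_iff_rslice (δ : V →ₗ[ℂ] V ⊗[ℂ] H) :
    IsRightCoaction δ ↔ (∀ v, rslice (Coalgebra.counit (R := ℂ) (A := H)) (δ v) = v) ∧
      ∀ (g g' : H →ₗ[ℂ] ℂ) (v : V),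
        rslice g (δ (rslice g' (δ v))) = rslice (formMul g g') (δ v) := by
  have h1 : ∀ (g g' : H →ₗ[ℂ] ℂ) (t : V ⊗[ℂ] H), TensorProduct.rid ℂ V
      ((g' ∘ₗ slice g).lTensor V (TensorProduct.assoc ℂ V H H (δ.rTensor H t))) =
      rslice g (δ (rslice g' t)) := by
    intro g g' t
    induction t with
    | zero => simp
    | tmul v a =>
      simp only [LinearMap.rTensor_tmul, rslice_tmul, map_smul]
      induction δ v with
      | zero => simp
      | tmul p q => simp [smul_smul, mul_comm]
      | add x y hx hy => simp_all [TensorProduct.add_tmul]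
    | add x y hx hy => simp [hx, hy]
  have h2 : ∀ (g g' : H →ₗ[ℂ] ℂ) (t : V ⊗[ℂ] H), TensorProduct.rid ℂ V
      ((g' ∘ₗ slice g).lTensor V ((Coalgebra.comul (R := ℂ) (A := H)).lTensor V t)) =
      rslice (formMul g g') t := by
    intro g g' t
    induction t with
    | zero => simp
    | tmul v a => simp [formMul]
    | add x y hx hy => simp [hx, hy]
  constructor
  · intro h
    refine ⟨h.counit, fun g g' v => ?_⟩
    rw [← h1, h.coassoc, h2]
  · intro h
    refine ⟨h.1, fun v => tensor_ext_forms fun g g' => ?_⟩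
    rw [h1, h.2, h2]

theorem IsRightCoaction.of_injective {δ : V →ₗ[ℂ] V ⊗[ℂ] H} {δ' : V' →ₗ[ℂ] V' ⊗[ℂ] H}
    (e : V →ₗ[ℂ] V') (he : Function.Injective e)
    (h : ∀ g v, rslice g (δ' (e v)) = e (rslice g (δ v)))
    (hδ : IsRightCoaction δ') : IsRightCoaction δ := by
  rw [isRightCoaction_iff_rslice] at hδ ⊢
  refine ⟨fun v => he ?_, fun g g' v => he ?_⟩
  · rw [← h, hδ.1]
  · rw [← h, ← h, ← h, hδ.2]

theorem isSimpleComodule_iff (δ : V →ₗ[ℂ] V ⊗[ℂ] H) :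
    IsSimpleComodule δ ↔ Nontrivial V ∧ ∀ W : Submodule ℂ V,
      (∀ v ∈ W, ∀ g : H →ₗ[ℂ] ℂ, rslice g (δ v) ∈ W) → W = ⊥ ∨ W = ⊤ := by
  constructor
  · intro h
    refine ⟨?_, fun W hW => h.eq_or W le_top ((isSubcomodule_iff_rslice δ W).2 hW)⟩
    by_contra hn
    rw [not_nontrivial_iff_subsingleton] at hn
    exact h.ne_bot (Subsingleton.elim _ _)
  · rintro ⟨hn, h⟩
    exact ⟨(isSubcomodule_iff_rslice _ _).2 fun _ _ _ => trivial, top_ne_bot,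
      fun W _ hW => h W ((isSubcomodule_iff_rslice _ _).1 hW)⟩

theorem IsSimpleComodule.of_equiv {δ : V →ₗ[ℂ] V ⊗[ℂ] H} {δ' : V' →ₗ[ℂ] V' ⊗[ℂ] H}
    (e : V ≃ₗ[ℂ] V')
    (h : ∀ W : Submodule ℂ V', (∀ v ∈ W, ∀ g : H →ₗ[ℂ] ℂ, rslice g (δ' v) ∈ W) →
      ∀ v, e v ∈ W → ∀ g : H →ₗ[ℂ] ℂ, e (rslice g (δ v)) ∈ W)
    (hδ : IsSimpleComodule δ) : IsSimpleComodule δ' := by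
  rw [isSimpleComodule_iff] at hδ ⊢
  have := hδ.1
  refine ⟨e.toEquiv.symm.nontrivial, fun W hW => ?_⟩
  rcases hδ.2 (W.comap e.toLinearMap) fun v hv g => h W hW v hv g with h0 | h0
  · left
    rw [eq_bot_iff]
    intro x hx
    have : e.symm x ∈ W.comap e.toLinearMap := by simpa using hx
    rw [h0] at this
    simpa using this
  · right
    rw [eq_top_iff]
    intro x _
    have : e.symm x ∈ W.comap e.toLinearMap := by rw [h0]; trivial
    simpa using this

/-- The coaction on a subcomodule. -/
theorem IsSubcomodule.exists_restrict {δ : V →ₗ[ℂ] V ⊗[ℂ] H} {W : Submodule ℂ V}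
    (hW : IsSubcomodule δ W) :
    ∃ δ' : W →ₗ[ℂ] W ⊗[ℂ] H, ∀ w, W.subtype.rTensor H (δ' w) = δ w := by
  obtain ⟨P, hP⟩ := LinearMap.exists_leftInverse_of_injective W.subtype W.ker_subtype
  refine ⟨P.rTensor H ∘ₗ δ ∘ₗ W.subtype, fun w => ?_⟩
  obtain ⟨t, ht⟩ := hW w w.2
  simp only [LinearMap.comp_apply, Submodule.subtype_apply, ← ht]
  rw [← LinearMap.comp_apply (P.rTensor H), ← LinearMap.rTensor_comp, hP, LinearMap.rTensor_id,
    LinearMap.id_apply]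

theorem IsSimpleSubcomodule.restrict {δ : V →ₗ[ℂ] V ⊗[ℂ] H} {W : Submodule ℂ V}
    (hW : IsSimpleSubcomodule δ W) {δ' : W →ₗ[ℂ] W ⊗[ℂ] H}
    (h : ∀ w, W.subtype.rTensor H (δ' w) = δ w) : IsSimpleComodule δ' := by
  have h' : ∀ (g : H →ₗ[ℂ] ℂ) (w : W), (rslice (V := W) g (δ' w) : V) = rslice g (δ w) := by
    intro g w
    rw [← h, rslice_rTensor]; rfl
  rw [isSimpleComodule_iff]
  refine ⟨Submodule.nontrivial_iff_ne_bot.2 hW.ne_bot, fun W' hW' => ?_⟩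
  have := hW.eq_or (W'.map W.subtype) (Submodule.map_subtype_le _ _) ?_
  · rcases this with h0 | h0
    · left
      exact (Submodule.map_injective_of_injective W.subtype_injective) (by simpa using h0)
    · right
      apply Submodule.map_injective_of_injective W.subtype_injective
      rw [h0, Submodule.map_subtype_top]
  · rw [isSubcomodule_iff_rslice]
    rintro _ ⟨v, hv, rfl⟩ g
    exact ⟨_, hW' v hv g, h' g v⟩

end Slices

/-! ### Local finiteness of the regular comodule. -/

section LocalFiniteness

variable {H : Type u} [Ring H] [HopfAlgebra ℂ H]

theorem isRightCoaction_comul :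
    IsRightCoaction (Coalgebra.comul (R := ℂ) (A := H)) where
  counit v := by simp
  coassoc v := by simp

theorem rslice_comul_rslice_comul (g g' : H →ₗ[ℂ] ℂ) (x : H) :
    rslice g (Coalgebra.comul (R := ℂ) (rslice g' (Coalgebra.comul (R := ℂ) x))) =
      rslice (formMul g g') (Coalgebra.comul (R := ℂ) x) :=
  ((isRightCoaction_iff_rslice _).1 isRightCoaction_comul).2 g g' x

@[simp]
theorem rslice_counit_comul (x : H) :
    rslice Coalgebra.counit (Coalgebra.comul (R := ℂ) x) = x :=
  ((isRightCoaction_iff_rslice _).1 isRightCoaction_comul).1 x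

@[simp]
theorem slice_counit_comul (x : H) :
    slice Coalgebra.counit (Coalgebra.comul (R := ℂ) x) = x := by
  simp [slice]

theorem exists_finiteDimensional_slices {V : Type*} [AddCommGroup V] [Module ℂ V]
    (t : V ⊗[ℂ] H) :
    ∃ (A : Submodule ℂ V) (B : Submodule ℂ H), FiniteDimensional ℂ A ∧ FiniteDimensional ℂ B ∧
      (∀ g : H →ₗ[ℂ] ℂ, rslice g t ∈ A) ∧ t ∈ LinearMap.range (B.subtype.lTensor V) := by
  induction t with
  | zero => exact ⟨⊥, ⊥, inferInstance, inferInstance, by simp, zero_mem _⟩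
  | tmul v h =>
    refine ⟨Submodule.span ℂ {v}, Submodule.span ℂ {h}, inferInstance, inferInstance, fun g => ?_,
      v ⊗ₜ ⟨h, Submodule.mem_span_singleton_self h⟩, by simp⟩
    rw [rslice_tmul]
    exact Submodule.smul_mem _ _ (Submodule.mem_span_singleton_self v)
  | add x y hx hy =>
    obtain ⟨A, B, hA, hB, h1, h2⟩ := hx
    obtain ⟨A', B', hA', hB', h1', h2'⟩ := hy
    refine ⟨A ⊔ A', B ⊔ B', inferInstance, inferInstance, fun g => ?_, add_mem ?_ ?_⟩
    · rw [map_add]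
      exact add_mem (Submodule.mem_sup_left (h1 g)) (Submodule.mem_sup_right (h1' g))
    · obtain ⟨s, rfl⟩ := h2
      refine ⟨(Submodule.inclusion le_sup_left).lTensor V s, ?_⟩
      rw [← LinearMap.comp_apply, ← LinearMap.lTensor_comp]; rfl
    · obtain ⟨s, rfl⟩ := h2'
      refine ⟨(Submodule.inclusion le_sup_right).lTensor V s, ?_⟩
      rw [← LinearMap.comp_apply, ← LinearMap.lTensor_comp]; rfl

/-- Every element of `H` lies in a finite-dimensional subcomodule. -/
theorem exists_finiteDimensional_subcomodule (x : H) :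
    ∃ W : Submodule ℂ H, FiniteDimensional ℂ W ∧ x ∈ W ∧
      ∀ y ∈ W, ∀ g : H →ₗ[ℂ] ℂ, rslice g (Coalgebra.comul (R := ℂ) y) ∈ W := by
  let F : (H →ₗ[ℂ] ℂ) →ₗ[ℂ] H :=
    { toFun := fun g => rslice g (Coalgebra.comul (R := ℂ) x)
      map_add' := fun g g' => rslice_add g g' _
      map_smul' := fun c g => rslice_smul c g _ }
  obtain ⟨A, -, hA, -, h, -⟩ := exists_finiteDimensional_slices (Coalgebra.comul (R := ℂ) x)
  -- The orbit of `x` under the dual algebra: the counit recovers `x`, and the left legs of a finite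
  -- expression for `Δ x` bound the dimension.
  refine ⟨LinearMap.range F, ?_, ⟨Coalgebra.counit, rslice_counit_comul x⟩, ?_⟩
  · refine Submodule.finiteDimensional_of_le (S₂ := A) ?_
    rintro _ ⟨g, rfl⟩
    exact h g
  · rintro _ ⟨g', rfl⟩ g
    exact ⟨formMul g g', (rslice_comul_rslice_comul g g' x).symm⟩

end LocalFiniteness

/-! ### Matrix form of coactions. -/

section Corepresentations

variable {H : Type u} [Ring H] [HopfAlgebra ℂ H]
variable {ι : Type*} [Fintype ι] [DecidableEq ι]

/-- `u` is the matrix of a right coaction. -/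
structure IsCorep (u : Matrix ι ι H) : Prop where
  comul : ∀ i j, Coalgebra.comul (R := ℂ) (u i j) = ∑ k, u i k ⊗ₜ[ℂ] u k j
  counit : ∀ i j, Coalgebra.counit (R := ℂ) (u i j) = if i = j then 1 else 0

variable {V : Type*} [AddCommGroup V] [Module ℂ V]

/-- The linear map `V → V ⊗ H` with matrix `u` in the basis `b`. -/
def matCoact (b : Module.Basis ι ℂ V) (u : Matrix ι ι H) : V →ₗ[ℂ] V ⊗[ℂ] H :=
  b.constr ℂ fun j => ∑ i, b i ⊗ₜ u i j

theorem matCoact_basis (b : Module.Basis ι ℂ V) (u : Matrix ι ι H) (j : ι) :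
    matCoact b u (b j) = ∑ i, b i ⊗ₜ u i j := by
  simp [matCoact]

theorem rslice_matCoact_basis (b : Module.Basis ι ℂ V) (u : Matrix ι ι H) (g : H →ₗ[ℂ] ℂ) (j : ι) :
    rslice g (matCoact b u (b j)) = ∑ i, g (u i j) • b i := by
  simp [matCoact_basis]

theorem eq_matCoact (b : Module.Basis ι ℂ V) (δ : V →ₗ[ℂ] V ⊗[ℂ] H) :
    δ = matCoact b (Matrix.of fun i j => slice (b.coord i) (δ (b j))) := by
  refine b.ext fun j => tensor_ext_rslice fun g => ?_
  rw [rslice_matCoact_basis]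
  simp_rw [Matrix.of_apply, map_slice_eq_map_rslice, Module.Basis.coord_apply]
  exact (b.sum_repr _).symm

theorem IsCorep.isRightCoaction (b : Module.Basis ι ℂ V) {u : Matrix ι ι H} (hu : IsCorep u) :
    IsRightCoaction (matCoact b u) := by
  rw [isRightCoaction_iff_rslice]
  constructor
  · intro v
    have : rslice Coalgebra.counit ∘ₗ matCoact b u = LinearMap.id := by
      refine b.ext fun j => ?_
      simp [rslice_matCoact_basis, hu.counit]
    exact LinearMap.congr_fun this v
  · intro g g' v
    have : rslice g ∘ₗ matCoact b u ∘ₗ rslice g' ∘ₗ matCoact b u =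
        rslice (formMul g g') ∘ₗ matCoact b u := by
      refine b.ext fun j => ?_
      simp only [LinearMap.comp_apply, rslice_matCoact_basis, map_sum, map_smul, Finset.smul_sum,
        formMul, hu.comul, slice_tmul, smul_eq_mul, Finset.sum_smul, smul_smul]
      rw [Finset.sum_comm]
      simp only [mul_comm]
    exact LinearMap.congr_fun this v

theorem IsRightCoaction.isCorep (b : Module.Basis ι ℂ V) {u : Matrix ι ι H}
    (h : IsRightCoaction (matCoact b u)) : IsCorep u := by
  rw [isRightCoaction_iff_rslice] at h
  refine ⟨fun i j => ?_, fun i j => ?_⟩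
  · refine tensor_ext_rslice fun g' => ?_
    rw [← sub_eq_zero]
    refine (Module.forall_dual_apply_eq_zero_iff ℂ _).1 fun g => ?_
    rw [map_sub, sub_eq_zero]
    have := congr_arg (b.coord i) (h.2 g g' (b j))
    simp only [rslice_matCoact_basis, map_sum, map_smul, Module.Basis.coord_apply,
      Module.Basis.repr_self, smul_eq_mul, Finsupp.single_apply, mul_ite,
      mul_one, mul_zero, Finset.sum_ite_eq', Finset.mem_univ, if_true, formMul,
      LinearMap.comp_apply] at this
    rw [← map_slice_eq_map_rslice, ← this]
    simp
  · have := congr_arg (b.coord i) (h.1 (b j))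
    simpa [rslice_matCoact_basis, Finsupp.single_apply, eq_comm] using this

end Corepresentations

/-! ### Spanning of `H` by coefficients of unitary simple comodules. -/

section UnitaryCorepresentations

variable {H : Type u} [Ring H] [HopfAlgebra ℂ H] [StarRing H]

/-- `u` is the matrix of a simple unitary comodule in an orthonormal basis. -/
structure IsSimpleUnitaryCorep {n : ℕ} (u : Matrix (Fin n) (Fin n) H) : Prop extends IsCorep u where
  antipode : ∀ i j, HopfAlgebra.antipode ℂ (u i j) = star (u j i)
  simple : IsSimpleComodule (matCoact (EuclideanSpace.basisFun (Fin n) ℂ).toBasis u)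

theorem IsScalarProduct.exists_orthonormal_basis {V : Type*} [AddCommGroup V] [Module ℂ V]
    [FiniteDimensional ℂ V] {B : V →ₗ⋆[ℂ] V →ₗ[ℂ] ℂ} (hB : IsScalarProduct B) :
    ∃ (n : ℕ) (b : Module.Basis (Fin n) ℂ V), ∀ i, B (b i) = b.coord i := by
  let core : InnerProductSpace.Core ℂ V :=
    { inner := fun v w => B v w
      conj_inner_symm := fun v w => hB.conj_symm w v
      re_inner_nonneg := fun v => by
        by_cases hv : v = 0
        · simp [hv]
        · exact (hB.pos v hv).le
      add_left := fun v w z => by simp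
      smul_left := fun v w c => by simp
      definite := fun v hv => by
        by_contra h
        have := hB.pos v h
        rw [show B v v = 0 from hv] at this
        simp at this }
  let _ : NormedAddCommGroup V := core.toNormedAddCommGroup
  let _ : InnerProductSpace ℂ V := InnerProductSpace.ofCore core.toCore
  let b := stdOrthonormalBasis ℂ V
  refine ⟨_, b.toBasis, fun i => b.toBasis.ext fun j => ?_⟩
  have : B (b i) (b j) = if i = j then 1 else 0 := orthonormal_iff_ite.1 b.orthonormal i j
  simp [this]

theorem IsCompactHopfStarAlgebra.exists_simpleUnitaryCorep (hH : IsCompactHopfStarAlgebra H)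
    {V : Type} [AddCommGroup V] [Module ℂ V] [FiniteDimensional ℂ V] {δ : V →ₗ[ℂ] V ⊗[ℂ] H}
    (hδ : IsRightCoaction δ) (hs : IsSimpleComodule δ) :
    ∃ (n : ℕ) (b : Module.Basis (Fin n) ℂ V) (u : Matrix (Fin n) (Fin n) H),
      IsSimpleUnitaryCorep u ∧ δ = matCoact b u := by
  obtain ⟨B, hB, hB'⟩ := hH.unitarizable V δ hδ hs
  obtain ⟨n, b, hb⟩ := hB.exists_orthonormal_basis
  have h := eq_matCoact b δ
  refine ⟨n, b, _, ⟨(h ▸ hδ).isCorep b, fun i j => ?_, ?_⟩, h⟩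
  · have := hB' (b j) (b i)
    simpa only [hb] using! this
  · let e := b.equiv (EuclideanSpace.basisFun (Fin n) ℂ).toBasis (Equiv.refl _)
    refine hs.of_equiv e fun W hW v hv g => ?_
    have : e.toLinearMap ∘ₗ rslice g ∘ₗ δ = rslice g ∘ₗ matCoact
        (EuclideanSpace.basisFun (Fin n) ℂ).toBasis
        (Matrix.of fun i j => slice (b.coord i) (δ (b j))) ∘ₗ e.toLinearMap := by
      refine b.ext fun j => ?_
      conv_lhs => rw [h]
      simp only [LinearMap.comp_apply, rslice_matCoact_basis, LinearEquiv.coe_coe, e,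
        Module.Basis.equiv_apply, map_sum, map_smul, Equiv.refl_apply]
    have := LinearMap.congr_fun this v
    simp only [LinearMap.comp_apply, LinearEquiv.coe_coe] at this
    rw [this]
    exact hW _ hv g

omit [StarRing H] in
theorem slice_matCoact_mem_span {V ι : Type*} [AddCommGroup V] [Module ℂ V] [Fintype ι]
    [DecidableEq ι] (b : Module.Basis ι ℂ V)
    (u : Matrix ι ι H) (f : V →ₗ[ℂ] ℂ) (v : V) :
    slice f (matCoact b u v) ∈ Submodule.span ℂ {y | ∃ i j, u i j = y} := by
  rw [← b.sum_repr v]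
  simp only [map_sum, map_smul, matCoact_basis, slice_tmul]
  exact Submodule.sum_mem _ fun j _ => Submodule.smul_mem _ _ <| Submodule.sum_mem _ fun i _ =>
    Submodule.smul_mem _ _ <| Submodule.subset_span ⟨i, j, rfl⟩

/-- A compact Hopf `*`-algebra is spanned by the coefficients of its simple unitary comodules. -/
theorem IsCompactHopfStarAlgebra.mem_span (hH : IsCompactHopfStarAlgebra H) (x : H) :
    x ∈ Submodule.span ℂ {y | ∃ (n : ℕ) (u : Matrix (Fin n) (Fin n) H),
      IsSimpleUnitaryCorep u ∧ ∃ i j, u i j = y} := by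
  obtain ⟨W, hW, hx, hsub⟩ := exists_finiteDimensional_subcomodule x
  obtain ⟨δ, hδ⟩ := ((isSubcomodule_iff_rslice _ W).2 hsub).exists_restrict
  let b := Module.finBasis ℂ W
  let u : Matrix _ _ H := Matrix.of fun i j => slice (b.coord i) (δ (b j))
  have hδu : δ = matCoact b u := eq_matCoact b δ
  have hδc : IsRightCoaction δ := isRightCoaction_comul.of_injective W.subtype
    W.subtype_injective fun g v => by
      rw [← rslice_rTensor, hδ]; rfl
  have hu : IsCorep u := (hδu ▸ hδc).isCorep b
  -- Cosemisimplicity concerns comodules in `Type`, while `W` lives in `Type u`; the same matrix `u`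
  -- is therefore transported to `ℂⁿ`.
  let c := Pi.basisFun ℂ (Fin (Module.finrank ℂ W))
  obtain ⟨m, X, hX, hXs⟩ := hH.cosemisimple _ (matCoact c u) (hu.isRightCoaction c)
  have key : ∀ (f : (Fin (Module.finrank ℂ W) → ℂ) →ₗ[ℂ] ℂ) v, slice f (matCoact c u v) ∈
      Submodule.span ℂ {y | ∃ (n : ℕ) (u : Matrix (Fin n) (Fin n) H),
        IsSimpleUnitaryCorep u ∧ ∃ i j, u i j = y} := by
    intro f v
    have hv : v ∈ ⨆ i, X i := by rw [hX.submodule_iSup_eq_top]; trivial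
    induction hv using Submodule.iSup_induction' with
    | zero => simp
    | add v w _ _ hv hw => rw [map_add, map_add]; exact add_mem hv hw
    | mem i v hv =>
      obtain ⟨δ', hδ'⟩ := (hXs i).isSub.exists_restrict
      obtain ⟨n, b', u', hu', rfl⟩ := hH.exists_simpleUnitaryCorep (V := X i)
        ((hu.isRightCoaction c).of_injective (X i).subtype (X i).subtype_injective fun g v => by
          rw [← rslice_rTensor, hδ']; rfl) ((hXs i).restrict hδ')
      rw [← hδ' ⟨v, hv⟩, slice_rTensor]
      refine Submodule.span_mono ?_ (slice_matCoact_mem_span b' u' _ _)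
      exact fun y hy => ⟨n, u', hu', hy⟩
  -- The identity `x = ε(x₁) x₂` exhibits `x` as a combination of coefficients of `W`.
  have : slice (Coalgebra.counit (R := ℂ) ∘ₗ W.subtype) (δ ⟨x, hx⟩) = x := by
    rw [← slice_rTensor, hδ, slice_counit_comul]
  rw [← this, hδu, ← b.sum_repr ⟨x, hx⟩]
  simp only [map_sum, map_smul, matCoact_basis, slice_tmul]
  refine Submodule.sum_mem _ fun j _ => Submodule.smul_mem _ _ <| Submodule.sum_mem _ fun i _ =>
    Submodule.smul_mem _ _ ?_
  simpa [matCoact_basis, Finsupp.single_apply, ite_smul] using key (c.coord i) (c j)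

theorem IsCompactHopfStarAlgebra.induction (hH : IsCompactHopfStarAlgebra H) {p : H → Prop}
    (coeff : ∀ (n : ℕ) (u : Matrix (Fin n) (Fin n) H), IsSimpleUnitaryCorep u → ∀ i j, p (u i j))
    (zero : p 0) (add : ∀ x y, p x → p y → p (x + y)) (smul : ∀ (c : ℂ) x, p x → p (c • x))
    (x : H) : p x := by
  induction hH.mem_span x using Submodule.span_induction with
  | mem x h =>
    obtain ⟨n, u, hu, i, j, rfl⟩ := h
    exact coeff n u hu i j
  | zero => exact zero
  | add x y _ _ hx hy => exact add x y hx hy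
  | smul c x _ hx => exact smul c x hx

theorem IsCompactHopfStarAlgebra.hom_ext (hH : IsCompactHopfStarAlgebra H) {M : Type*}
    [AddCommMonoid M] [Module ℂ M] {f g : H →ₗ[ℂ] M}
    (h : ∀ (n : ℕ) (u : Matrix (Fin n) (Fin n) H), IsSimpleUnitaryCorep u →
      ∀ i j, f (u i j) = g (u i j)) (x : H) : f x = g x :=
  hH.induction (p := fun x => f x = g x) h (by simp) (fun x y hx hy => by simp [hx, hy])
    (fun c x hx => by simp [hx]) x

end UnitaryCorepresentations

/-! ### The antipode on coefficients. -/

section Antipode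

open HopfAlgebra

variable {H : Type u} [Ring H] [HopfAlgebra ℂ H] {ι : Type*} [Fintype ι] [DecidableEq ι]
  {u : Matrix ι ι H}

theorem IsCorep.sum_antipode_mul (hu : IsCorep u) (i j : ι) :
    ∑ k, antipode ℂ (u i k) * u k j = if i = j then 1 else 0 := by
  have := mul_antipode_rTensor_comul_apply (R := ℂ) (u i j)
  rw [hu.comul, hu.counit] at this
  simpa [apply_ite] using this

theorem IsCorep.sum_mul_antipode (hu : IsCorep u) (i j : ι) :
    ∑ k, u i k * antipode ℂ (u k j) = if i = j then 1 else 0 := by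
  have := mul_antipode_lTensor_comul_apply (R := ℂ) (u i j)
  rw [hu.comul, hu.counit] at this
  simpa [apply_ite] using this

/-- Over `H ⊗ H`, one side is a right inverse and the other a left inverse of the matrix `Δ(u)`, so
they coincide. -/
theorem IsCorep.comul_antipode (hu : IsCorep u) (i j : ι) :
    Coalgebra.comul (R := ℂ) (antipode ℂ (u i j)) =
      ∑ k, antipode ℂ (u k j) ⊗ₜ[ℂ] antipode ℂ (u i k) := by
  let A : Matrix ι ι (H ⊗[ℂ] H) := Matrix.of fun i j => Coalgebra.comul (R := ℂ) (u i j)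
  let X : Matrix ι ι (H ⊗[ℂ] H) :=
    Matrix.of fun i j => Coalgebra.comul (R := ℂ) (antipode ℂ (u i j))
  let Y : Matrix ι ι (H ⊗[ℂ] H) :=
    Matrix.of fun i j => ∑ k, antipode ℂ (u k j) ⊗ₜ[ℂ] antipode ℂ (u i k)
  have h1 : A * X = 1 := by
    ext i j
    simp only [A, X, Matrix.mul_apply, Matrix.of_apply, ← Bialgebra.comul_mul, ← map_sum,
      hu.sum_mul_antipode, Matrix.one_apply]
    split_ifs <;> simp
  have h2 : Y * A = 1 := by
    ext i j
    simp only [A, Y, Matrix.mul_apply, Matrix.of_apply, hu.comul, Finset.sum_mul, Finset.mul_sum,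
      Algebra.TensorProduct.tmul_mul_tmul, Matrix.one_apply]
    calc _ = ∑ l, ∑ m, (∑ k, antipode ℂ (u l k) * u k m) ⊗ₜ[ℂ] (antipode ℂ (u i l) * u m j) := by
          simp only [TensorProduct.sum_tmul]
          rw [Finset.sum_comm]
          conv_lhs =>
            enter [2, k]
            rw [Finset.sum_comm]
          rw [Finset.sum_comm]
      _ = (1 : H) ⊗ₜ[ℂ] ∑ l, (antipode ℂ (u i l) * u l j) := by
          simp [hu.sum_antipode_mul, TensorProduct.ite_tmul, ← TensorProduct.tmul_sum]
      _ = _ := by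
          rw [hu.sum_antipode_mul]
          split_ifs <;> simp [Algebra.TensorProduct.one_def]
  exact congr_fun (congr_fun (left_inv_eq_right_inv h2 h1).symm i) j

variable [StarRing H]

theorem IsCompactHopfStarAlgebra.comul_antipode (hH : IsCompactHopfStarAlgebra H) (x : H) :
    Coalgebra.comul (R := ℂ) (antipode ℂ x) = TensorProduct.map (antipode ℂ) (antipode ℂ)
      (TensorProduct.comm ℂ H H (Coalgebra.comul x)) := by
  have := hH.hom_ext (f := Coalgebra.comul ∘ₗ antipode ℂ)
    (g := TensorProduct.map (antipode ℂ) (antipode ℂ) ∘ₗ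
      (TensorProduct.comm ℂ H H).toLinearMap ∘ₗ Coalgebra.comul) ?_ x
  · exact this
  · intro n u hu i j
    simp [hu.comul_antipode, hu.comul]

theorem IsCompactHopfStarAlgebra.isCorep_antipode_antipode (hH : IsCompactHopfStarAlgebra H)
    (hu : IsCorep u) : IsCorep (u.map fun x => antipode ℂ (antipode ℂ x)) where
  comul i j := by
    simp [hH.comul_antipode, hu.comul]
  counit i j := by simp [hu.counit]

/-- On unitary coefficients `S` and `*` differ only by transposing the indices. The identity also
makes `S` injective. -/
theorem IsCompactHopfStarAlgebra.antipode_star_antipode [StarModule ℂ H]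
    (hH : IsCompactHopfStarAlgebra H) (x : H) :
    antipode ℂ (star (antipode ℂ x)) = star x := by
  refine hH.induction (p := fun x => antipode ℂ (star (antipode ℂ x)) = star x) ?_ (by simp)
    (fun x y hx hy => by simp [hx, hy]) (fun c x hx => by simp [hx]) x
  intro n u hu i j
  rw [hu.antipode, star_star, hu.antipode]

theorem IsCompactHopfStarAlgebra.antipode_injective [StarModule ℂ H]
    (hH : IsCompactHopfStarAlgebra H) : Function.Injective (antipode ℂ (A := H)) := by
  intro x y hxy
  apply star_injective
  rw [← hH.antipode_star_antipode, hxy, hH.antipode_star_antipode]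

end Antipode

/-! ### Symmetries and strong invariance of the integral. -/

section Integral

open HopfAlgebra

variable {H : Type u} [Ring H] [HopfAlgebra ℂ H] [StarRing H] {φ : H →ₗ[ℂ] ℂ}

theorem IsNormalizedIntegral.rslice_comul {H : Type u} [Ring H] [HopfAlgebra ℂ H]
    {φ : H →ₗ[ℂ] ℂ} (hφ : IsNormalizedIntegral φ) (x : H) :
    rslice φ (Coalgebra.comul (R := ℂ) x) = φ x • 1 :=
  hφ.left_inv x

theorem IsNormalizedIntegral.sum_smul_coeff {H ι : Type*} [Ring H] [HopfAlgebra ℂ H]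
    [Fintype ι] [DecidableEq ι] {φ : H →ₗ[ℂ] ℂ} (hφ : IsNormalizedIntegral φ) {u : Matrix ι ι H}
    (hu : IsCorep u) (i j : ι) : ∑ k, φ (u k j) • u i k = φ (u i j) • 1 := by
  rw [← hφ.rslice_comul, hu.comul]
  simp

theorem IsNormalizedIntegral.sum_antipode_smul_coeff (hφ : IsNormalizedIntegral φ)
    [StarModule ℂ H] (hH : IsCompactHopfStarAlgebra H) {ι : Type*} [Fintype ι] [DecidableEq ι]
    {u : Matrix ι ι H} (hu : IsCorep u) (i j : ι) :
    ∑ k, φ (antipode ℂ (u i k)) • u k j = φ (antipode ℂ (u i j)) • 1 := by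
  apply hH.antipode_injective
  have := hφ.rslice_comul (antipode ℂ (u i j))
  rw [hu.comul_antipode] at this
  simpa using this

/-- For the scalar matrices `P = φ(u)` and `Q = φ(S(u))`, invariance gives `u P = P` and `Q u = Q`.
Applying `φ ∘ S` to the first and `φ` to the second gives `P = Q P = Q`. -/
theorem IsNormalizedIntegral.map_antipode (hφ : IsNormalizedIntegral φ)
    [StarModule ℂ H] (hH : IsCompactHopfStarAlgebra H) (x : H) : φ (antipode ℂ x) = φ x := by
  refine hH.hom_ext (f := φ ∘ₗ antipode ℂ) (g := φ) (fun n u hu i j => ?_) x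
  have h1 := congr_arg φ (hφ.sum_antipode_smul_coeff hH hu.toIsCorep i j)
  have h2 := congr_arg (φ ∘ₗ antipode ℂ) (hφ.sum_smul_coeff hu.toIsCorep i j)
  simp only [map_sum, map_smul, smul_eq_mul, hφ.map_one, mul_one, LinearMap.comp_apply,
    antipode_one] at h1 h2
  rw [LinearMap.comp_apply, ← h1, ← h2]
  simp only [mul_comm]

/-- For `P = φ(u)`, conjugating `u P = P` and using unitarity yields `P* = P* P`, so `P` is
self-adjoint. -/
theorem IsNormalizedIntegral.map_star (hφ : IsNormalizedIntegral φ)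
    [StarModule ℂ H] (hH : IsCompactHopfStarAlgebra H) (x : H) : φ (star x) = star (φ x) := by
  refine hH.induction (p := fun x => φ (star x) = star (φ x)) (fun n u hu => ?_) (by simp)
    (fun x y hx hy => by simp [hx, hy]) (fun c x hx => by simp [hx]) x
  have h1 : ∀ m j, star (φ (u m j)) • (1 : H) = ∑ i, star (φ (u i j)) • u i m := by
    intro m j
    have h : ∀ i, ∑ k, star (φ (u k j)) • antipode ℂ (u k i) = star (φ (u i j)) • (1 : H) := by
      intro i
      have := congr_arg star (hφ.sum_smul_coeff hu.toIsCorep i j)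
      simpa only [star_sum, star_smul, star_one, ← hu.antipode] using this
    calc star (φ (u m j)) • (1 : H)
        = ∑ k, star (φ (u k j)) • ∑ i, antipode ℂ (u k i) * u i m := by
          simp [hu.sum_antipode_mul]
      _ = ∑ i, (∑ k, star (φ (u k j)) • antipode ℂ (u k i)) * u i m := by
          simp only [Finset.smul_sum, Finset.sum_mul, smul_mul_assoc]
          exact Finset.sum_comm
      _ = _ := by simp only [h, smul_mul_assoc, one_mul]
  have h2 : ∀ m j, star (φ (u m j)) = ∑ i, star (φ (u i j)) * φ (u i m) := by
    intro m j
    have := congr_arg φ (h1 m j)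
    simpa [hφ.map_one] using this
  intro i j
  rw [← hu.antipode, hφ.map_antipode hH, ← star_star (φ (u j i)), h2, h2 i j]
  simp [mul_comm]

theorem rslice_mul_tmul {H : Type u} [Ring H] [HopfAlgebra ℂ H] (g : H →ₗ[ℂ] ℂ) (t : H ⊗[ℂ] H)
    (p q : H) :
    rslice g (t * p ⊗ₜ[ℂ] q) = rslice (g ∘ₗ LinearMap.mulRight ℂ q) t * p := by
  induction t with
  | zero => simp
  | tmul x y => simp
  | add x y hx hy => simp [hx, hy, add_mul]

/-- Strong invariance of the integral. -/
theorem IsNormalizedIntegral.rslice_integralAgainst (hφ : IsNormalizedIntegral φ)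
    (hH : IsCompactHopfStarAlgebra H) (h a : H) :
    rslice (integralAgainst φ h) (Coalgebra.comul (R := ℂ) a) = convMul φ h a := by
  refine hH.induction (p := fun h => rslice (integralAgainst φ h) (Coalgebra.comul (R := ℂ) a) =
    convMul φ h a) (fun n u hu i j => ?_) ?_ (fun x y hx hy => ?_) (fun c x hx => ?_) h
  -- Invariance applied to `a S(u i l)`; multiplying by `u` on the right then cancels the factor
  -- `S(u)`.
  · have h1 : ∀ l, ∑ m, rslice (integralAgainst φ (u i m)) (Coalgebra.comul (R := ℂ) a) *
        antipode ℂ (u m l) = φ (a * antipode ℂ (u i l)) • 1 := by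
      intro l
      rw [← hφ.rslice_comul, Bialgebra.comul_mul, hu.comul_antipode, Finset.mul_sum, map_sum]
      simp only [rslice_mul_tmul, integralAgainst]
    calc rslice (integralAgainst φ (u i j)) (Coalgebra.comul (R := ℂ) a)
        = ∑ m, rslice (integralAgainst φ (u i m)) (Coalgebra.comul (R := ℂ) a) *
          ∑ l, antipode ℂ (u m l) * u l j := by simp [hu.sum_antipode_mul]
      _ = ∑ l, (∑ m, rslice (integralAgainst φ (u i m)) (Coalgebra.comul (R := ℂ) a) *
          antipode ℂ (u m l)) * u l j := by
          simp only [Finset.mul_sum, Finset.sum_mul, mul_assoc]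
          exact Finset.sum_comm
      _ = convMul φ (u i j) a := by
          simp [h1, convMul, hu.comul, integralMulAntipode]
  · simp [convMul, integralAgainst, rslice]
  · have : integralAgainst φ (x + y) = integralAgainst φ x + integralAgainst φ y := by
      ext; simp [integralAgainst, mul_add]
    rw [this, rslice_add, hx, hy, convMul_add_left]
  · have : integralAgainst φ (c • x) = c • integralAgainst φ x := by
      ext; simp [integralAgainst]
    rw [this, rslice_smul, hx]
    simp [convMul]

end Integral

/-! ### Nondegeneracy of the pairing `∫ a S(h)`. -/

section Nondegenerate

open HopfAlgebra

variable {H : Type u} [Ring H] [HopfAlgebra ℂ H] {φ : H →ₗ[ℂ] ℂ}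

variable (φ) in
/-- The linear map `h ↦ ∫ (· S(h))`. -/
def integralAgainstHom : H →ₗ[ℂ] H →ₗ[ℂ] ℂ where
  toFun := integralAgainst φ
  map_add' x y := by ext; simp [integralAgainst, mul_add]
  map_smul' c x := by ext; simp [integralAgainst]

theorem integralAgainstHom_apply (h a : H) :
    integralAgainstHom φ h a = φ (a * antipode ℂ h) := rfl

theorem integralAgainst_apply (h a : H) : integralAgainst φ h a = φ (a * antipode ℂ h) := rfl

/-- The kernel `N` of the pairing is a right ideal and, by strong invariance, a right subcomodule.
For `x ∈ N` this puts `x₁ S(x₂) = ε(x) 1` in `N`; as `1 ∉ N`, the counit vanishes on `N`, and a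
subcomodule killed by the counit is zero. -/
theorem IsNormalizedIntegral.eq_zero_of_integralAgainst [StarRing H]
    (hφ : IsNormalizedIntegral φ) (hH : IsCompactHopfStarAlgebra H) {g : H}
    (hg : integralAgainst φ g = 0) : g = 0 := by
  let N : Submodule ℂ H := LinearMap.ker (integralAgainstHom φ)
  have hN : ∀ x, x ∈ N ↔ ∀ a, φ (a * antipode ℂ x) = 0 := fun x => by
    simp only [N, LinearMap.mem_ker, LinearMap.ext_iff, integralAgainstHom_apply,
      LinearMap.zero_apply]
  have hmul : ∀ x ∈ N, ∀ b, x * b ∈ N := fun x hx b => (hN _).2 fun a => by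
    rw [antipode_mul_antidistrib, ← mul_assoc]
    exact (hN x).1 hx _
  have hco : ∀ x ∈ N, ∀ ξ : H →ₗ[ℂ] ℂ, rslice ξ (Coalgebra.comul (R := ℂ) x) ∈ N := by
    refine fun x hx ξ => (hN _).2 fun a => ?_
    have h1 : integralAgainst φ x = 0 := hx
    have h2 := hφ.rslice_integralAgainst hH x a
    rw [h1, show rslice (0 : H →ₗ[ℂ] ℂ) (Coalgebra.comul (R := ℂ) a) = 0 by simp [rslice]] at h2
    have h3 := congr_arg ξ h2
    rw [map_zero, convMul, map_slice_eq_map_rslice] at h3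
    exact h3.symm
  have hcounit : ∀ x ∈ N, Coalgebra.counit (R := ℂ) x = 0 := by
    intro x hx
    by_contra h0
    obtain ⟨t, ht⟩ := (mem_range_rTensor_subtype_iff N _).2 (hco x hx)
    have h1 : ∀ t : N ⊗[ℂ] H,
        LinearMap.mul' ℂ H ((antipode ℂ).lTensor H (N.subtype.rTensor H t)) ∈ N := by
      intro t
      induction t with
      | zero => simp
      | tmul v h => simpa using hmul v v.2 _
      | add x y hx hy => rw [map_add, map_add, map_add]; exact add_mem hx hy
    have h2 := h1 t
    rw [ht, mul_antipode_lTensor_comul_apply, Algebra.algebraMap_eq_smul_one] at h2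
    have h3 : (1 : H) ∈ N := by
      have := N.smul_mem (Coalgebra.counit (R := ℂ) x)⁻¹ h2
      rwa [smul_smul, inv_mul_cancel₀ h0, one_smul] at this
    have := (hN 1).1 h3 1
    rw [antipode_one, mul_one, hφ.map_one] at this
    exact one_ne_zero this
  refine (Module.forall_dual_apply_eq_zero_iff ℂ g).1 fun ξ => ?_
  have := hcounit _ (hco g hg ξ)
  rwa [← map_slice_eq_map_rslice, slice_counit_comul] at this

end Nondegenerate

/-! ### Comodules as modules over the convolution algebra. -/

section Action

open HopfAlgebra

variable {H : Type u} [Ring H] [HopfAlgebra ℂ H] [StarRing H] {φ : H →ₗ[ℂ] ℂ}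
variable {V : Type*} [AddCommGroup V] [Module ℂ V] {δ : V →ₗ[ℂ] V ⊗[ℂ] H}

omit [StarRing H] in
theorem convAct_apply (h : ConvAlg φ) (v : V) :
    convAct φ δ h v = rslice (integralAgainst φ h) (δ v) := rfl

/-- Strong invariance, used twice. It makes `h ↦ ∫(· S(h))` multiplicative into the dual algebra,
which turns comodules into modules. -/
theorem IsNormalizedIntegral.formMul_integralAgainst (hφ : IsNormalizedIntegral φ)
    (hH : IsCompactHopfStarAlgebra H) (g f : H) :
    formMul (integralAgainst φ g) (integralAgainst φ f) = integralAgainst φ (convMul φ g f) := by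
  ext a
  rw [formMul, LinearMap.comp_apply, LinearMap.comp_apply, map_slice_eq_map_rslice,
    hφ.rslice_integralAgainst hH, convMul, map_slice_eq_map_rslice,
    hφ.rslice_integralAgainst hH]
  rfl

theorem IsNormalizedIntegral.convAct_mul (hφ : IsNormalizedIntegral φ)
    (hH : IsCompactHopfStarAlgebra H) (hδ : IsRightCoaction δ) (g f : ConvAlg φ) :
    convAct φ δ (g * f) = convAct φ δ g ∘ₗ convAct φ δ f := by
  ext v
  rw [LinearMap.comp_apply, convAct_apply, convAct_apply, convAct_apply,
    ((isRightCoaction_iff_rslice δ).1 hδ).2]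
  exact congr_arg (fun ξ => rslice ξ (δ v)) (hφ.formMul_integralAgainst hH g f).symm

omit [StarRing H] in
theorem convAct_add (g f : ConvAlg φ) :
    convAct φ δ (g + f) = convAct φ δ g + convAct φ δ f := by
  ext v
  exact (congr_arg (fun ξ => rslice ξ (δ v)) ((integralAgainstHom φ).map_add g f)).trans
    (rslice_add _ _ _)

omit [StarRing H] in
theorem convAct_smul (c : ℂ) (f : ConvAlg φ) :
    convAct φ δ (c • f) = c • convAct φ δ f := by
  ext v
  exact (congr_arg (fun ξ => rslice ξ (δ v)) ((integralAgainstHom φ).map_smul c f)).trans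
    (rslice_smul _ _ _)

theorem SimpleStarModule.op_star (l : SimpleStarModule φ) (f : ConvAlg φ) :
    l.op (star f) = star (l.op f) := by
  rw [ContinuousLinearMap.star_eq_adjoint, ContinuousLinearMap.eq_adjoint_iff]
  exact fun x y => (l.isStar f y x).symm

/-- The representation of the convolution algebra on a simple comodule. -/
def SimpleStarModule.rep (hφ : IsNormalizedIntegral φ)
    (hH : IsCompactHopfStarAlgebra H) (l : SimpleStarModule φ) :
    ConvAlg φ →⋆ₙₐ[ℂ] (EuclideanSpace ℂ (Fin l.dim) →L[ℂ] EuclideanSpace ℂ (Fin l.dim)) where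
  toFun := l.op
  map_smul' c f := by
    ext1 v
    exact LinearMap.congr_fun (convAct_smul c f) v
  map_zero' := by
    ext1 v
    have := LinearMap.congr_fun (convAct_smul (δ := l.coact) 0 (0 : ConvAlg φ)) v
    rw [zero_smul, zero_smul] at this
    exact this
  map_add' f g := by
    ext1 v
    exact LinearMap.congr_fun (convAct_add f g) v
  map_mul' f g := by
    ext1 v
    exact LinearMap.congr_fun (hφ.convAct_mul hH l.isCoaction f g) v
  map_star' := l.op_star

end Action

/-! ### Enough simple `⋆`-modules. -/

section ManyModules

variable {H : Type u} [Ring H] [HopfAlgebra ℂ H] [StarRing H] [StarModule ℂ H] {φ : H →ₗ[ℂ] ℂ}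

local notation "S" => HopfAlgebra.antipode ℂ

/-- This is the adjoint relation for the matrix `S²(u)`. The twist lets `∫ ∘ S² = ∫` remove both
squares at once, after which `∫ ∘ * = conj ∘ ∫` and unitarity apply. -/
theorem IsSimpleUnitaryCorep.star_map_antipode_antipode (hφ : IsNormalizedIntegral φ)
    (hH : IsCompactHopfStarAlgebra H) {n : ℕ} {u : Matrix (Fin n) (Fin n) H}
    (hu : IsSimpleUnitaryCorep u) (h : H) (i j : Fin n) :
    star (φ (S (S (u i j)) * S (S (star h)))) = φ (S (S (u j i)) * S h) := by
  rw [← HopfAlgebra.antipode_mul_antidistrib, ← HopfAlgebra.antipode_mul_antidistrib,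
    ← HopfAlgebra.antipode_mul_antidistrib, hφ.map_antipode hH, hφ.map_antipode hH,
    hφ.map_antipode hH, ← hφ.map_star hH, star_mul, star_star, hu.antipode]

omit [StarRing H] [StarModule ℂ H] in
theorem rslice_matCoact_sesq {n : ℕ} {u : Matrix (Fin n) (Fin n) H} {g g' : H →ₗ[ℂ] ℂ}
    (h : ∀ i j, star (g' (u i j)) = g (u j i)) (v w : EuclideanSpace ℂ (Fin n)) :
    inner ℂ w (rslice g (matCoact (EuclideanSpace.basisFun (Fin n) ℂ).toBasis u v)) =
      inner ℂ (rslice g' (matCoact (EuclideanSpace.basisFun (Fin n) ℂ).toBasis u w)) v := by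
  let b := EuclideanSpace.basisFun (Fin n) ℂ
  let A := rslice g' ∘ₗ matCoact b.toBasis u
  let B := rslice g ∘ₗ matCoact b.toBasis u
  have : A = LinearMap.adjoint B := by
    refine (LinearMap.eq_adjoint_iff_basis b.toBasis b.toBasis A B).2 fun i j => ?_
    have hA : A (b.toBasis i) = ∑ k, g' (u k i) • b k := by
      simpa only [OrthonormalBasis.coe_toBasis] using! rslice_matCoact_basis b.toBasis u g' i
    have hB : B (b.toBasis j) = ∑ k, g (u k j) • b k := by
      simpa only [OrthonormalBasis.coe_toBasis] using! rslice_matCoact_basis b.toBasis u g j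
    rw [hA, hB, OrthonormalBasis.coe_toBasis]
    simp only [sum_inner, inner_sum, inner_smul_left, inner_smul_right,
      orthonormal_iff_ite.1 b.orthonormal, mul_ite, mul_one, mul_zero, Finset.sum_ite_eq,
      Finset.sum_ite_eq', Finset.mem_univ, if_true]
    exact h j i
  change inner ℂ w (B v) = inner ℂ (A w) v
  rw [this, LinearMap.adjoint_inner_left]

/-- The square of the antipode turns a unitary simple comodule into a `⋆`-module over the
convolution algebra. -/
def IsSimpleUnitaryCorep.toSimpleStarModule (hφ : IsNormalizedIntegral φ)
    (hH : IsCompactHopfStarAlgebra H) {n : ℕ} {u : Matrix (Fin n) (Fin n) H}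
    (hu : IsSimpleUnitaryCorep u) : SimpleStarModule φ where
  dim := n
  coact := matCoact (EuclideanSpace.basisFun (Fin n) ℂ).toBasis (u.map fun x => S (S x))
  isCoaction := (hH.isCorep_antipode_antipode hu.toIsCorep).isRightCoaction _
  isSimple := by
    refine hu.simple.of_equiv (LinearEquiv.refl ℂ _) fun W hW v hv g => ?_
    -- Since `S²` is injective, every form on the coefficients of `u` is a form on those of `S²(u)`,
    -- so twisting creates no new subcomodules.
    obtain ⟨T, hT⟩ := LinearMap.exists_leftInverse_of_injective
      (HopfAlgebra.antipode ℂ ∘ₗ HopfAlgebra.antipode ℂ (A := H))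
      (LinearMap.ker_eq_bot.2 (hH.antipode_injective.comp hH.antipode_injective))
    have h := hW v hv (g ∘ₗ T)
    have : rslice g ∘ₗ matCoact (EuclideanSpace.basisFun (Fin n) ℂ).toBasis u =
        rslice (g ∘ₗ T) ∘ₗ matCoact (EuclideanSpace.basisFun (Fin n) ℂ).toBasis
          (u.map fun x => S (S x)) := by
      refine (EuclideanSpace.basisFun (Fin n) ℂ).toBasis.ext fun j => ?_
      have hT' : ∀ x, T (S (S x)) = x := LinearMap.congr_fun hT
      simp only [LinearMap.comp_apply, rslice_matCoact_basis, Matrix.map_apply, hT']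
    have := LinearMap.congr_fun this v
    simp only [LinearMap.comp_apply] at this
    rwa [← this] at h
  isStar h v w := rslice_matCoact_sesq (fun i j => hu.star_map_antipode_antipode hφ hH h i j) v w

/-- Nondegeneracy in the other variable, obtained from the first by conjugation, with `star (S f)`
in the role of `g`. -/
theorem IsNormalizedIntegral.eq_zero_of_mul_antipode (hφ : IsNormalizedIntegral φ)
    (hH : IsCompactHopfStarAlgebra H) {f : H} (h : ∀ x : H, φ (f * S x) = 0) : f = 0 := by
  have h' : star f = 0 := by
    have : S (star (S f)) = star f := hH.antipode_star_antipode f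
    have h0 : star (S f) = 0 := hφ.eq_zero_of_integralAgainst hH <| by
      ext a
      rw [integralAgainst_apply, this, ← star_star a, ← star_mul, hφ.map_star hH,
        ← hH.antipode_star_antipode a, h, star_zero, LinearMap.zero_apply]
    rw [← this, h0, map_zero]
  exact star_eq_zero.1 h'

theorem IsNormalizedIntegral.eq_zero_of_op_eq_zero (hφ : IsNormalizedIntegral φ)
    (hH : IsCompactHopfStarAlgebra H) {f : H}
    (hf : ∀ l : SimpleStarModule φ, l.op f = 0) : f = 0 := by
  refine hφ.eq_zero_of_mul_antipode hH <| by
    refine hH.hom_ext (f := φ ∘ₗ LinearMap.mulLeft ℂ f ∘ₗ HopfAlgebra.antipode ℂ) (g := 0) ?_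
    intro n u hu i j
    let l := hu.toSimpleStarModule hφ hH
    let b := (EuclideanSpace.basisFun (Fin n) ℂ).toBasis
    have h1 : rslice (integralAgainst φ f) (matCoact b (u.map fun x => S (S x)) (b j)) = 0 := by
      change l.op f (b j) = 0
      rw [hf l]
      rfl
    rw [rslice_matCoact_basis] at h1
    have h2 := Fintype.linearIndependent_iff.1 b.linearIndependent _ h1 i
    rw [integralAgainst_apply, Matrix.map_apply, ← HopfAlgebra.antipode_mul_antidistrib,
      hφ.map_antipode hH] at h2
    exact h2

end ManyModules

/-! ### A uniform bound on all `*`-representations. -/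

section Bound

variable {H : Type u} [Ring H] [HopfAlgebra ℂ H] [StarRing H] {φ : H →ₗ[ℂ] ℂ}

/-- Every element lies in a finite-dimensional left ideal of the convolution algebra. -/
theorem IsNormalizedIntegral.exists_finiteDimensional_leftIdeal (hφ : IsNormalizedIntegral φ)
    (hH : IsCompactHopfStarAlgebra H) (x : ConvAlg φ) :
    ∃ C : Submodule ℂ (ConvAlg φ), FiniteDimensional ℂ C ∧ x ∈ C ∧
      ∀ h, ∀ y ∈ C, h * y ∈ C := by
  obtain ⟨W, hW, hx, h⟩ := exists_finiteDimensional_subcomodule (H := H) x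
  refine ⟨W, hW, hx, fun f y hy => ?_⟩
  have key : ∀ f y : H, y ∈ W → convMul φ f y ∈ W := fun f y hy => by
    -- Strong invariance: subcomodules of `H` are left ideals for convolution.
    rw [← hφ.rslice_integralAgainst hH]
    exact h y hy _
  exact key f y hy

omit [StarRing H] in
variable (φ) in
/-- Left convolution is linear. -/
theorem ConvAlg.mul_smul_right (c : ℂ) (h f : ConvAlg φ) : h * (c • f) = c • (h * f) := by
  have h1 : ∀ f : H, integralMulAntipode φ (c • f) = c • integralMulAntipode φ f := fun f => by
    ext x; simp [integralMulAntipode]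
  have h2 : ∀ h f : H, convMul φ h (c • f) = c • convMul φ h f := fun h f => by
    simp [convMul, h1, slice, LinearMap.rTensor_smul]
  exact h2 h f

/-- If `μ ≠ 0` is not an eigenvalue of `T`, solve `(μ - T) c = x₀`; then `μ⁻¹ (1 + L c)` is a right
inverse of `μ - b`. It is also a left inverse because `b` is self-adjoint and `μ` real. -/
theorem spectrum_subset_of_intertwining {B X : Type*} [CStarAlgebra B] [AddCommGroup X] [Module ℂ X]
    (T : Module.End ℂ X) (L : X →ₗ[ℂ] B) {b : B} (hb : IsSelfAdjoint b)
    (hL : ∀ x, L (T x) = b * L x) {x₀ : X} (h₀ : L x₀ = b) [FiniteDimensional ℂ X] :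
    spectrum ℂ b ⊆ insert 0 (spectrum ℂ T) := by
  intro μ hμ
  rw [Set.mem_insert_iff, or_iff_not_imp_left]
  intro hμ0
  by_contra hT
  rw [spectrum.notMem_iff] at hT
  obtain ⟨c, hc⟩ := ((Module.End.isUnit_iff _).1 hT).surjective x₀
  have h1 : μ • L c - b * L c = b := by
    rw [← hL, ← map_smul, ← map_sub, ← h₀, ← hc]
    rfl
  have hμr : star μ = μ := Complex.conj_eq_iff_re.2 (hb.mem_spectrum_eq_re hμ).symm
  have h2 : (algebraMap ℂ B μ - b) * (μ⁻¹ • (1 + L c)) = 1 := by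
    rw [mul_smul_comm, mul_add, mul_one, sub_mul, ← Algebra.smul_def, h1, sub_add_cancel,
      Algebra.algebraMap_eq_smul_one, smul_smul, inv_mul_cancel₀ hμ0, one_smul]
  have h3 : star (μ⁻¹ • (1 + L c)) * (algebraMap ℂ B μ - b) = 1 := by
    have := congr_arg star h2
    rwa [star_mul, star_sub, hb.star_eq, star_one, ← algebraMap_star_comm, hμr] at this
  exact hμ ⟨⟨_, _, h2, left_inv_eq_right_inv h3 h2 ▸ h3⟩, rfl⟩

theorem IsSelfAdjoint.exists_mem_spectrum_norm_eq {B : Type*} [CStarAlgebra B] [Nontrivial B]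
    {b : B} (hb : IsSelfAdjoint b) : ∃ μ ∈ spectrum ℂ b, ‖μ‖ = ‖b‖ := by
  obtain ⟨μ, hμ, hμn⟩ := spectrum.exists_nnnorm_eq_spectralRadius b
  rw [hb.spectralRadius_eq_nnnorm] at hμn
  have : ‖μ‖₊ = ‖b‖₊ := by exact_mod_cast hμn
  exact ⟨μ, hμ, congr_arg (fun r : NNReal => (r : ℝ)) this⟩

/-- The norms of an element in the `*`-representations of the convolution algebra are bounded. -/
theorem IsNormalizedIntegral.exists_norm_le (hφ : IsNormalizedIntegral φ)
    (hH : IsCompactHopfStarAlgebra H) (f : ConvAlg φ) :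
    ∃ R : ℝ, ∀ (B : Type w) [CStarAlgebra B] (ψ : ConvAlg φ →⋆ₙₐ[ℂ] B), ‖ψ f‖ ≤ R := by
  obtain ⟨C, hC, hh, hmul⟩ := hφ.exists_finiteDimensional_leftIdeal hH (star f * f)
  set h := star f * f
  let T : Module.End ℂ C :=
    { toFun := fun y => ⟨h * y, hmul h y y.2⟩
      map_add' := fun x y => Subtype.ext (mul_add h (x : ConvAlg φ) y)
      map_smul' := fun c y => Subtype.ext (ConvAlg.mul_smul_right φ c h y) }
  -- `T` depends only on `f`, so `R` is chosen before `B` and `ψ`; it bounds `‖ψ h‖ = ‖ψ f‖²`.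
  obtain ⟨R, hR⟩ := ((Module.End.finite_spectrum T).insert 0).isBounded.exists_norm_le
  refine ⟨√R, fun B _ ψ => Real.le_sqrt_of_sq_le ?_⟩
  rcases subsingleton_or_nontrivial B with hB | hB
  · rw [Subsingleton.elim (ψ f) 0, norm_zero]
    simpa using hR 0 (Set.mem_insert _ _)
  have hsa : IsSelfAdjoint (ψ h) := by
    rw [map_mul, StarHomClass.map_star]
    exact IsSelfAdjoint.star_mul_self _
  have hn : ‖ψ f‖ ^ 2 = ‖ψ h‖ := by
    rw [map_mul, StarHomClass.map_star, CStarRing.norm_star_mul_self, sq]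
  obtain ⟨μ, hμ, hμn⟩ := hsa.exists_mem_spectrum_norm_eq
  let L : C →ₗ[ℂ] B :=
    { toFun := fun y => ψ y
      map_add' := fun x y => map_add ψ (x : ConvAlg φ) y
      map_smul' := fun c y => map_smul ψ c (y : ConvAlg φ) }
  rw [hn, ← hμn]
  exact hR μ (spectrum_subset_of_intertwining T L hsa (fun y => map_mul ψ h y)
    (x₀ := ⟨h, hh⟩) rfl hμ)

end Bound

/-! ### The dense embedding into the completion. -/

section Embedding

variable {H : Type u} [Ring H] [HopfAlgebra ℂ H] [StarRing H] {φ : H →ₗ[ℂ] ℂ}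

theorem BoundedFamilies.ext {T T' : BoundedFamilies φ}
    (h : ∀ l, T.component l = T'.component l) : T = T' :=
  Subtype.ext (funext h)

/-- Evaluation of bounded families at a simple module. -/
def BoundedFamilies.componentHom (l : SimpleStarModule φ) : BoundedFamilies φ →⋆ₙₐ[ℂ]
    (EuclideanSpace ℂ (Fin l.dim) →L[ℂ] EuclideanSpace ℂ (Fin l.dim)) where
  toFun T := T.component l
  map_smul' _ _ := rfl
  map_zero' := rfl
  map_add' _ _ := rfl
  map_mul' _ _ := rfl
  map_star' _ := rfl

theorem IsNormalizedIntegral.bddAbove_norm_op (hφ : IsNormalizedIntegral φ)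
    (hH : IsCompactHopfStarAlgebra H) (f : ConvAlg φ) :
    BddAbove (Set.range fun l : SimpleStarModule φ => ‖l.op f‖) := by
  obtain ⟨R, hR⟩ := hφ.exists_norm_le hH f
  refine ⟨R, ?_⟩
  rintro _ ⟨l, rfl⟩
  exact hR _ (l.rep hφ hH)

/-- The convolution algebra in the algebra of bounded families. -/
def IsNormalizedIntegral.familyHom (hφ : IsNormalizedIntegral φ)
    (hH : IsCompactHopfStarAlgebra H) : ConvAlg φ →⋆ₙₐ[ℂ] BoundedFamilies φ where
  toFun f := ⟨fun l => l.op f, memℓp_infty (hφ.bddAbove_norm_op hH f)⟩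
  map_smul' c f := BoundedFamilies.ext fun l => map_smul (l.rep hφ hH) c f
  map_zero' := BoundedFamilies.ext fun l => map_zero (l.rep hφ hH)
  map_add' f g := BoundedFamilies.ext fun l => map_add (l.rep hφ hH) f g
  map_mul' f g := BoundedFamilies.ext fun l => map_mul (l.rep hφ hH) f g
  map_star' f := BoundedFamilies.ext fun l => l.op_star f

/-- The embedding of the convolution algebra into its completion. -/
def IsNormalizedIntegral.embedding (hφ : IsNormalizedIntegral φ)
    (hH : IsCompactHopfStarAlgebra H) : ConvAlg φ →⋆ₙₐ[ℂ] HCStar φ :=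
  NonUnitalStarAlgHom.codRestrict (hφ.familyHom hH) (HCStar φ) fun f =>
    NonUnitalStarSubalgebra.le_topologicalClosure _ <|
      NonUnitalStarAlgebra.subset_adjoin ℂ _ ⟨f, fun _ => rfl⟩

theorem IsNormalizedIntegral.component_embedding (hφ : IsNormalizedIntegral φ)
    (hH : IsCompactHopfStarAlgebra H) (f : ConvAlg φ) (l : SimpleStarModule φ) :
    (hφ.embedding hH f : BoundedFamilies φ).component l = l.op f := rfl

theorem IsNormalizedIntegral.norm_embedding (hφ : IsNormalizedIntegral φ)
    (hH : IsCompactHopfStarAlgebra H) (f : ConvAlg φ) :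
    ‖hφ.embedding hH f‖ = cstarNorm φ f := rfl

theorem IsNormalizedIntegral.embedding_injective [StarModule ℂ H] (hφ : IsNormalizedIntegral φ)
    (hH : IsCompactHopfStarAlgebra H) : Function.Injective (hφ.embedding hH) := by
  rw [injective_iff_map_eq_zero]
  intro f hf
  refine hφ.eq_zero_of_op_eq_zero hH fun l => ?_
  have := hφ.component_embedding hH f l
  rw [hf] at this
  exact this.symm

theorem IsNormalizedIntegral.denseRange_embedding (hφ : IsNormalizedIntegral φ)
    (hH : IsCompactHopfStarAlgebra H) : DenseRange (hφ.embedding hH) := by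
  have h : NonUnitalStarAlgebra.adjoin ℂ
      {T : BoundedFamilies φ | ∃ f : ConvAlg φ, ∀ l, T.component l = l.op f} ≤
      NonUnitalStarAlgHom.range (hφ.familyHom hH) := by
    refine NonUnitalStarAlgebra.adjoin_le ?_
    rintro T ⟨f, hf⟩
    exact ⟨f, BoundedFamilies.ext fun l => (hf l).symm⟩
  rw [DenseRange, Subtype.dense_iff]
  intro T hT
  refine closure_mono ?_ hT
  intro T hT
  obtain ⟨f, rfl⟩ := h hT
  exact ⟨_, ⟨f, rfl⟩, rfl⟩

end Embedding

/-! ### Irreducible representations and simple comodules. -/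

section FiniteDimensional

variable {H : Type u} [Ring H] [HopfAlgebra ℂ H] [StarRing H] {φ : H →ₗ[ℂ] ℂ}

/-- An irreducible representation is generated by the action of a finite-dimensional left ideal. -/
theorem IrredUnitaryRep.exists_eq_map_leftIdeal (hφ : IsNormalizedIntegral φ)
    (hH : IsCompactHopfStarAlgebra H) (σ : IrredUnitaryRep.{u, w} (ConvAlg φ)) :
    ∃ (C : Submodule ℂ (ConvAlg φ)) (v : σ.space), FiniteDimensional ℂ C ∧
      ∀ x, ∃ c ∈ C, σ.hom c v = x := by
  obtain ⟨h, hh⟩ := σ.ne_zero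
  obtain ⟨v, hv⟩ : ∃ v, σ.hom h v ≠ 0 := by
    by_contra! h0
    exact hh (ContinuousLinearMap.ext h0)
  obtain ⟨C, hC, hx, hmul⟩ := hφ.exists_finiteDimensional_leftIdeal hH h
  let F : ConvAlg φ →ₗ[ℂ] σ.space :=
    { toFun := fun c => σ.hom c v
      map_add' := fun x y => by simp
      map_smul' := fun c x => by simp }
  have := σ.irreducible (C.map F) (Submodule.closed_of_finiteDimensional _) ?_
  · refine ⟨C, v, hC, fun x => ?_⟩
    have hF : C.map F = ⊤ := by
      refine this.resolve_left fun h0 => hv ?_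
      have : F h ∈ C.map F := ⟨h, hx, rfl⟩
      rw [h0] at this
      exact this
    have hx : x ∈ C.map F := by rw [hF]; trivial
    exact hx
  · rintro a _ ⟨c, hc, rfl⟩
    refine ⟨a * c, hmul a c hc, ?_⟩
    change σ.hom (a * c) v = σ.hom a (σ.hom c v)
    rw [map_mul]
    rfl

theorem IrredUnitaryRep.finiteDimensional (hφ : IsNormalizedIntegral φ)
    (hH : IsCompactHopfStarAlgebra H) (σ : IrredUnitaryRep.{u, w} (ConvAlg φ)) :
    FiniteDimensional ℂ σ.space := by
  obtain ⟨C, v, hC, h⟩ := σ.exists_eq_map_leftIdeal hφ hH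
  let F : C →ₗ[ℂ] σ.space :=
    { toFun := fun c => σ.hom c v
      map_add' := fun x y => by simp
      map_smul' := fun c x => by simp }
  refine Module.Finite.of_surjective F fun x => ?_
  obtain ⟨c, hc, rfl⟩ := h x
  exact ⟨⟨c, hc⟩, rfl⟩

/-- On a finite-dimensional space of coefficients, the forms `∫ (· S(h))` contain a dual basis. -/
theorem IsNormalizedIntegral.exists_dual_family [StarModule ℂ H] (hφ : IsNormalizedIntegral φ)
    (hH : IsCompactHopfStarAlgebra H) (C : Submodule ℂ H) [FiniteDimensional ℂ C] :
    ∃ (n : ℕ) (h c : Fin n → H), ∀ x ∈ C, x = ∑ i, integralAgainst φ (h i) x • c i := by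
  let F : H →ₗ[ℂ] C →ₗ[ℂ] ℂ := (LinearMap.lcomp ℂ ℂ C.subtype) ∘ₗ integralAgainstHom φ
  -- The forms separate the points of the finite-dimensional `C`, so their restrictions fill its
  -- dual.
  have hF : Function.Surjective F := by
    rw [← LinearMap.flip_injective_iff₂, injective_iff_map_eq_zero]
    intro x hx
    exact Subtype.ext (hφ.eq_zero_of_mul_antipode hH (LinearMap.congr_fun hx))
  let b := Module.finBasis ℂ C
  choose h hh using fun i => hF (b.coord i)
  refine ⟨_, h, fun i => b i, fun x hx => ?_⟩
  have h1 := congr_arg Subtype.val (b.sum_repr ⟨x, hx⟩)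
  have h2 : ∀ i, b.repr ⟨x, hx⟩ i = integralAgainst φ (h i) x := fun i =>
    (LinearMap.congr_fun (hh i) ⟨x, hx⟩).symm
  simp only [h2] at h1
  simpa using h1.symm

theorem exists_finiteDimensional_comul_mem {H : Type u} [Ring H] [HopfAlgebra ℂ H]
    (C : Submodule ℂ H) [FiniteDimensional ℂ C] :
    ∃ B : Submodule ℂ H, FiniteDimensional ℂ B ∧
      ∀ x ∈ C, Coalgebra.comul (R := ℂ) x ∈ LinearMap.range (B.subtype.lTensor H) := by
  let b := Module.finBasis ℂ C
  choose A B hA hB h1 h2 using fun i =>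
    exists_finiteDimensional_slices (Coalgebra.comul (R := ℂ) (b i : H))
  refine ⟨⨆ i, B i, inferInstance, fun x hx => ?_⟩
  have hx' : x = ∑ i, b.repr ⟨x, hx⟩ i • (b i : H) := by
    conv_lhs => rw [show x = ((⟨x, hx⟩ : C) : H) from rfl, ← b.sum_repr ⟨x, hx⟩]
    simp only [Submodule.coe_sum, Submodule.coe_smul]
  rw [hx', map_sum]
  refine Submodule.sum_mem _ fun i _ => ?_
  rw [map_smul]
  refine Submodule.smul_mem _ _ ?_
  obtain ⟨s, hs⟩ := h2 i
  refine ⟨(Submodule.inclusion (le_iSup B i)).lTensor H s, ?_⟩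
  rw [← hs, ← LinearMap.comp_apply, ← LinearMap.lTensor_comp]
  rfl

/-- The operators of an irreducible representation are finite combinations of fixed ones. -/
theorem IrredUnitaryRep.exists_expansion [StarModule ℂ H] (hφ : IsNormalizedIntegral φ)
    (hH : IsCompactHopfStarAlgebra H) (σ : IrredUnitaryRep.{u, w} (ConvAlg φ)) :
    ∃ (n : ℕ) (h : Fin n → ConvAlg φ) (c : Fin n → H), ∀ (f : ConvAlg φ) (x : σ.space),
      σ.hom f x = ∑ i, integralAgainst φ f (c i) • σ.hom (h i) x := by
  obtain ⟨C, v, hC, hsurj⟩ : ∃ (C : Submodule ℂ H) (v : σ.space), FiniteDimensional ℂ C ∧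
      ∀ x, ∃ c ∈ C, σ.hom c v = x := σ.exists_eq_map_leftIdeal hφ hH
  obtain ⟨B, hB, hCB⟩ := exists_finiteDimensional_comul_mem C
  obtain ⟨n, h, c, hc⟩ := hφ.exists_dual_family hH B
  -- By strong invariance `f * x` depends on `f` only through `∫(· S(f))` on the right legs of `Δ
  -- x`, all lying in `B`.
  have key : ∀ (f x : H), x ∈ C →
      convMul φ f x = ∑ i, integralAgainst φ f (c i) • convMul φ (h i) x := by
    intro f x hx
    simp only [← hφ.rslice_integralAgainst hH]
    obtain ⟨s, hs⟩ := hCB x hx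
    rw [← hs]
    clear hs
    induction s with
    | zero => simp
    | tmul p q =>
      have := congr_arg (integralAgainst φ f) (hc q q.2)
      simp only [LinearMap.lTensor_tmul, Submodule.subtype_apply, rslice_tmul, smul_smul,
        ← Finset.sum_smul]
      rw [this]
      simp [mul_comm]
    | add s t hs ht => simp only [map_add, hs, ht, smul_add, Finset.sum_add_distrib]
  refine ⟨n, h, c, fun f x => ?_⟩
  obtain ⟨y, hy, rfl⟩ := hsurj x
  have h1 := congr_arg (fun z : ConvAlg φ => σ.hom z v) (key f y hy)
  have h2 : ∀ g : ConvAlg φ, σ.hom g (σ.hom y v) = σ.hom (convMul (H := H) φ g y) v := fun g =>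
    (congr_arg (fun T => T v) (map_mul σ.hom g (show ConvAlg φ from y))).symm
  have h3 : ∀ (s : Finset (Fin n)) (a : Fin n → ℂ) (z : Fin n → ConvAlg φ),
      σ.hom (∑ i ∈ s, a i • z i) v = ∑ i ∈ s, a i • σ.hom (z i) v := by
    intro s a z
    simp [map_sum]
  exact (h2 f).trans (h1.trans ((h3 _ _ _).trans (Finset.sum_congr rfl fun i _ =>
    congr_arg (integralAgainst φ f (c i) • ·) (h2 (h i)).symm)))

/-- The expansion of the operators dictates the coaction `v ↦ ∑ σ(h i) v ⊗ c i`. Multiplicativity of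
`σ` is coassociativity tested on the forms `∫(· S(f))`; as these separate points of `H`, it extends
to all forms, one slot at a time (`h1`, `h2`, `h3`). -/
theorem IrredUnitaryRep.exists_simpleStarModule [StarModule ℂ H] (hφ : IsNormalizedIntegral φ)
    (hH : IsCompactHopfStarAlgebra H) (σ : IrredUnitaryRep.{u, w} (ConvAlg φ)) :
    ∃ (l : SimpleStarModule φ) (U : EuclideanSpace ℂ (Fin l.dim) ≃ₗᵢ[ℂ] σ.space),
      ∀ f v, U (l.op f v) = σ.hom f (U v) := by
  have := σ.finiteDimensional hφ hH
  obtain ⟨C₀, v₀, _, hsurj⟩ := σ.exists_eq_map_leftIdeal hφ hH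
  obtain ⟨n, h, c, hc⟩ := σ.exists_expansion hφ hH
  let U : EuclideanSpace ℂ (Fin (Module.finrank ℂ σ.space)) ≃ₗᵢ[ℂ] σ.space :=
    (stdOrthonormalBasis ℂ σ.space).repr.symm
  let δ : EuclideanSpace ℂ (Fin (Module.finrank ℂ σ.space)) →ₗ[ℂ]
      EuclideanSpace ℂ (Fin (Module.finrank ℂ σ.space)) ⊗[ℂ] H :=
    ∑ i, (TensorProduct.mk ℂ _ H).flip (c i) ∘ₗ U.symm.toLinearEquiv.toLinearMap ∘ₗ
      (σ.hom (h i)).toLinearMap ∘ₗ U.toLinearEquiv.toLinearMap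
  have hδ : ∀ g v, rslice g (δ v) = ∑ i, g (c i) • U.symm (σ.hom (h i) (U v)) := by
    intro g v
    simp [δ]
  have hact : ∀ (f : ConvAlg φ) v, convAct φ δ f v = U.symm (σ.hom f (U v)) := by
    intro f v
    rw [convAct_apply, hδ, hc]
    simp
  have hact' : ∀ (f : H) v, rslice (integralAgainst φ f) (δ v) =
      U.symm (σ.hom (show ConvAlg φ from f) (U v)) := hact
  have heq : ∀ x y : H, (∀ f : H, integralAgainst φ f x = integralAgainst φ f y) → x = y := by
    intro x y hxy
    rw [← sub_eq_zero]
    refine hφ.eq_zero_of_mul_antipode hH fun f => ?_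
    rw [sub_mul, map_sub, sub_eq_zero]
    exact hxy f
  have h1 : ∀ (f f' : H) v, rslice (integralAgainst φ f) (δ (rslice (integralAgainst φ f') (δ v)))
      = rslice (formMul (integralAgainst φ f) (integralAgainst φ f')) (δ v) := by
    intro f f' v
    rw [hφ.formMul_integralAgainst hH, hact', hact', hact', U.apply_symm_apply]
    have := congr_arg (fun T => U.symm (T (U v)))
      (map_mul σ.hom (show ConvAlg φ from f) (show ConvAlg φ from f'))
    exact this.symm
  have h2 : ∀ (g : H →ₗ[ℂ] ℂ) (f' : H) v, rslice g (δ (rslice (integralAgainst φ f') (δ v)))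
      = rslice (formMul g (integralAgainst φ f')) (δ v) := by
    intro g f' v
    rw [← sub_eq_zero]
    refine (Module.forall_dual_apply_eq_zero_iff ℂ _).1 fun ξ => ?_
    have hg : ∀ g, ξ (rslice (formMul g (integralAgainst φ f')) (δ v)) =
        g (rslice (integralAgainst φ f') (Coalgebra.comul (R := ℂ) (slice ξ (δ v)))) := by
      intro g
      rw [← map_slice_eq_map_rslice, ← map_slice_eq_map_rslice]
      rfl
    rw [map_sub, sub_eq_zero, hg, ← map_slice_eq_map_rslice]
    congr 1
    refine heq _ _ fun f => ?_
    rw [← hg, map_slice_eq_map_rslice, h1]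
  have h3 : ∀ (g g' : H →ₗ[ℂ] ℂ) v, rslice g (δ (rslice g' (δ v)))
      = rslice (formMul g g') (δ v) := by
    intro g g' v
    rw [← sub_eq_zero]
    refine (Module.forall_dual_apply_eq_zero_iff ℂ _).1 fun ξ => ?_
    have hl : ∀ g', ξ (rslice g (δ (rslice g' (δ v)))) = g' (slice (ξ ∘ₗ rslice g ∘ₗ δ) (δ v)) := by
      intro g'
      rw [map_slice_eq_map_rslice]
      rfl
    have hr : ∀ g', ξ (rslice (formMul g g') (δ v)) =
        g' (slice g (Coalgebra.comul (R := ℂ) (slice ξ (δ v)))) := by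
      intro g'
      rw [← map_slice_eq_map_rslice]
      rfl
    rw [map_sub, sub_eq_zero, hl, hr]
    congr 1
    refine heq _ _ fun f => ?_
    rw [← hl, ← hr, h2]
  let l : SimpleStarModule φ :=
    { dim := _
      coact := δ
      isCoaction := by
        refine (isRightCoaction_iff_rslice δ).2 ⟨fun v => ?_, h3⟩
        -- Every vector has the form `f · v₀`, so the counit law reduces to `ε` being a unit for
        -- `formMul`.
        obtain ⟨f, -, hf⟩ := hsurj (U v)
        have hv : v = rslice (integralAgainst φ f) (δ (U.symm v₀)) := by
          rw [hact' f]
          simp [hf]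
        rw [hv, h3]
        congr 1
        ext a
        simp [formMul]
      isSimple := by
        rw [isSimpleComodule_iff]
        constructor
        · obtain ⟨a, ha⟩ := σ.ne_zero
          by_contra hn
          rw [not_nontrivial_iff_subsingleton] at hn
          refine ha (ContinuousLinearMap.ext fun x => ?_)
          rw [zero_apply, ← U.apply_symm_apply (σ.hom a x),
            Subsingleton.elim (U.symm (σ.hom a x)) 0, map_zero]
        · intro W hW
          have := σ.irreducible (W.map U.toLinearEquiv.toLinearMap)
            (Submodule.closed_of_finiteDimensional _) ?_
          · rcases this with h0 | h0
            · left
              exact (Submodule.map_injective_of_injective U.injective) (by simpa using h0)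
            · right
              apply Submodule.map_injective_of_injective
                (f := U.toLinearEquiv.toLinearMap) U.injective
              rw [h0, Submodule.map_top, LinearEquiv.range]
          · rintro a _ ⟨x, hx, rfl⟩
            refine ⟨_, hW x hx (integralAgainst φ a), ?_⟩
            rw [hact' a]
            exact U.apply_symm_apply _
      isStar := fun f v w => by
        rw [hact, hact, StarHomClass.map_star, ContinuousLinearMap.star_eq_adjoint,
          ← U.inner_map_map, U.apply_symm_apply, ← U.inner_map_map (U.symm _),
          U.apply_symm_apply, ContinuousLinearMap.adjoint_inner_left] }
  exact ⟨l, U, fun f v => by rw [← U.apply_symm_apply (σ.hom f (U v)), ← hact]; rfl⟩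

end FiniteDimensional

/-! ### Bijection of equivalence classes by restriction. -/

section Correspondence

theorem continuous_representation {A E : Type*} [NonUnitalCStarAlgebra A] [NormedAddCommGroup E]
    [InnerProductSpace ℂ E] [CompleteSpace E] (π : A →⋆ₙₐ[ℂ] (E →L[ℂ] E)) : Continuous π :=
  AddMonoidHomClass.continuous_of_bound π 1 fun a => by
    simpa only [one_mul] using NonUnitalStarAlgHom.norm_apply_le π a

variable {H : Type u} [Ring H] [HopfAlgebra ℂ H] [StarRing H] {φ : H →ₗ[ℂ] ℂ}

/-- Two continuous maps on the completion agree if they agree on the convolution algebra. -/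
theorem IsNormalizedIntegral.hom_apply_eq (hφ : IsNormalizedIntegral φ)
    (hH : IsCompactHopfStarAlgebra H) {E F : Type*} [NormedAddCommGroup E] [InnerProductSpace ℂ E]
    [CompleteSpace E] [NormedAddCommGroup F] [InnerProductSpace ℂ F] [CompleteSpace F]
    (π : HCStar φ →⋆ₙₐ[ℂ] (E →L[ℂ] E)) (π' : HCStar φ →⋆ₙₐ[ℂ] (F →L[ℂ] F)) (U : E →L[ℂ] F)
    (h : ∀ f v, U (π (hφ.embedding hH f) v) = π' (hφ.embedding hH f) (U v)) (a : HCStar φ) (v : E) :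
    U (π a v) = π' a (U v) := by
  have hπ : Continuous π := continuous_representation π
  have hπ' : Continuous π' := continuous_representation π'
  exact (hφ.denseRange_embedding hH).induction_on (p := fun a => U (π a v) = π' a (U v)) a
    (isClosed_eq (by fun_prop) (by fun_prop)) fun f => h f v

/-- Restriction of an irreducible representation of the completion to the convolution algebra. -/
def IrredUnitaryRep.restrict (hφ : IsNormalizedIntegral φ)
    (hH : IsCompactHopfStarAlgebra H) (ρ : IrredUnitaryRep.{u, w} (HCStar φ)) :
    IrredUnitaryRep.{u, w} (ConvAlg φ) where
  space := ρ.space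
  hom := ρ.hom.comp (hφ.embedding hH)
  ne_zero := by
    by_contra! h
    obtain ⟨a, ha⟩ := ρ.ne_zero
    have hc : Continuous ρ.hom := continuous_representation ρ.hom
    exact ha ((hφ.denseRange_embedding hH).induction_on (p := fun a => ρ.hom a = 0) a
      (isClosed_eq hc continuous_const) h)
  irreducible K hK h := ρ.irreducible K hK fun a v hv => by
    have hc : Continuous ρ.hom := continuous_representation ρ.hom
    exact (hφ.denseRange_embedding hH).induction_on (p := fun a => ρ.hom a v ∈ K) a
      (hK.preimage (by fun_prop)) fun f => h f v hv

theorem IrredUnitaryRep.restrict_equiv_iff (hφ : IsNormalizedIntegral φ)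
    (hH : IsCompactHopfStarAlgebra H) (ρ ρ' : IrredUnitaryRep.{u, w} (HCStar φ)) :
    ρ.restrict hφ hH ≈ ρ'.restrict hφ hH ↔ ρ ≈ ρ' := by
  constructor
  · rintro ⟨U, hU⟩
    let U' : ρ.space ≃ₗᵢ[ℂ] ρ'.space := U
    exact ⟨U, hφ.hom_apply_eq hH ρ.hom ρ'.hom
      U'.toContinuousLinearEquiv.toContinuousLinearMap hU⟩
  · rintro ⟨U, hU⟩
    exact ⟨U, fun f v => hU _ v⟩

theorem IrredUnitaryRep.exists_restrict_equiv [StarModule ℂ H] (hφ : IsNormalizedIntegral φ)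
    (hH : IsCompactHopfStarAlgebra H) (σ : IrredUnitaryRep.{u, w} (ConvAlg φ)) :
    ∃ ρ : IrredUnitaryRep.{u, w} (HCStar φ), ρ.restrict hφ hH ≈ σ := by
  obtain ⟨l, U, hU⟩ := σ.exists_simpleStarModule hφ hH
  -- The extension is evaluation at the component `l`, transported by `U`.
  let π : HCStar φ →⋆ₙₐ[ℂ] (σ.space →L[ℂ] σ.space) :=
    U.conjStarAlgEquiv.toNonUnitalStarAlgHom.comp
      ((BoundedFamilies.componentHom l).comp (NonUnitalStarSubalgebraClass.subtype (HCStar φ)))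
  have hπ : ∀ f, π (hφ.embedding hH f) = σ.hom f := fun f => by
    ext v
    change U (l.op f (U.symm v)) = _
    rw [hU, U.apply_symm_apply]
  refine ⟨⟨σ.space, π, ?_, fun K hK h => σ.irreducible K hK fun f v hv => ?_⟩,
    LinearIsometryEquiv.refl ℂ σ.space, fun f v => ?_⟩
  · obtain ⟨f, hf⟩ := σ.ne_zero
    exact ⟨_, (hπ f).trans_ne hf⟩
  · rw [← hπ]
    exact h _ v hv
  · exact congr_arg (fun T : σ.space →L[ℂ] σ.space => T v) (hπ f)

theorem IsNormalizedIntegral.exists_irredClasses_equiv [StarModule ℂ H]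
    (hφ : IsNormalizedIntegral φ) (hH : IsCompactHopfStarAlgebra H) :
    ∃ e : IrredClasses.{u, w} (HCStar φ) ≃ IrredClasses.{u, w} (ConvAlg φ),
      ∀ (ρ : IrredUnitaryRep.{u, w} (HCStar φ)) (σ : IrredUnitaryRep.{u, w} (ConvAlg φ)),
        e (Quotient.mk _ ρ) = Quotient.mk _ σ ↔
          ∃ U : ρ.space ≃ₗᵢ[ℂ] σ.space, ∀ f v,
            U (ρ.hom (hφ.embedding hH f) v) = σ.hom f (U v) := by
  let F : IrredClasses.{u, w} (HCStar φ) → IrredClasses.{u, w} (ConvAlg φ) :=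
    Quotient.map (fun ρ => ρ.restrict hφ hH) fun ρ ρ' =>
      (IrredUnitaryRep.restrict_equiv_iff hφ hH ρ ρ').2
  have hF : Function.Bijective F := by
    constructor
    · rintro ⟨ρ⟩ ⟨ρ'⟩ h
      exact Quotient.sound ((IrredUnitaryRep.restrict_equiv_iff hφ hH ρ ρ').1 (Quotient.exact h))
    · rintro ⟨σ⟩
      obtain ⟨ρ, hρ⟩ := σ.exists_restrict_equiv hφ hH
      exact ⟨Quotient.mk _ ρ, Quotient.sound hρ⟩
  exact ⟨Equiv.ofBijective F hF, fun ρ σ => Quotient.eq⟩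

end Correspondence

/-! ### Minimal projections in finite-dimensional operator algebras. -/

section MinimalProjections

variable {B : Type*} [CStarAlgebra B]

/-- A nonzero self-adjoint element of a finite-dimensional `*`-algebra of operators has a spectral
projection in that algebra. -/
theorem NonUnitalStarSubalgebra.exists_spectral_projection (S : NonUnitalStarSubalgebra ℂ B)
    [FiniteDimensional ℂ S] {b : B} (hb : IsSelfAdjoint b) (hbS : b ∈ S) (hb0 : b ≠ 0) :
    ∃ q ∈ S, IsStarProjection q ∧ q ≠ 0 ∧ ∃ μ : ℂ, μ ≠ 0 ∧ b * q = μ • q ∧ q * b = μ • q := by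
  have : Nontrivial B := ⟨⟨b, 0, hb0⟩⟩
  obtain ⟨μ, hμ, hμn⟩ := hb.exists_mem_spectrum_norm_eq
  have hμ0 : μ ≠ 0 := by
    rw [← norm_ne_zero_iff, hμn, norm_ne_zero_iff]
    exact hb0
  let T : Module.End ℂ S :=
    { toFun := fun y => ⟨b * y, S.mul_mem hbS y.2⟩
      map_add' := fun x y => Subtype.ext (mul_add b (x : B) y)
      map_smul' := fun c y => Subtype.ext (mul_smul_comm c b (y : B)) }
  have hfin : (quasispectrum ℂ b).Finite := by
    rw [quasispectrum_eq_spectrum_union_zero]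
    refine (Set.Finite.subset ((Module.End.finite_spectrum T).insert 0) ?_).union
      (Set.finite_singleton 0)
    exact spectrum_subset_of_intertwining T (S.toNonUnitalSubalgebra.toSubmodule.subtype) hb
      (fun _ => rfl) (x₀ := ⟨b, hbS⟩) rfl
  have hμq : μ ∈ quasispectrum ℂ b := by
    rw [quasispectrum_eq_spectrum_union_zero]
    exact Or.inl hμ
  classical
  -- The quasispectrum is finite, so this indicator is continuous on it; `f 0 = 0`, as `μ ≠ 0`,
  -- keeps `cfcₙ f b` in the non-unital algebra.
  let f : ℂ → ℂ := fun z => if z = μ then 1 else 0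
  have hf0 : f 0 = 0 := if_neg hμ0.symm
  have hc : ∀ g : ℂ → ℂ, ContinuousOn g (quasispectrum ℂ b) := fun g => hfin.continuousOn g
  have hn : IsStarNormal b := hb.isStarNormal
  have hmul : b * cfcₙ f b = μ • cfcₙ f b := by
    have hid := cfcₙ_mul (fun z : ℂ => z) f b (hc _) rfl (hc _) hf0
    rw [cfcₙ_id' ℂ b] at hid
    rw [← hid, ← cfcₙ_const_mul _ _ _ (hc _) hf0]
    congr 1
    ext z
    by_cases hz : z = μ <;> simp [f, hz]
  have hsa : IsSelfAdjoint (cfcₙ f b) := by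
    rw [IsSelfAdjoint, ← cfcₙ_star]
    congr 1
    ext z
    by_cases hz : z = μ <;> simp [f, hz]
  refine ⟨cfcₙ f b, ?_, ⟨?_, hsa⟩, ?_, μ, hμ0, hmul, ?_⟩
  · have hcl : IsClosed (S : Set B) :=
      Submodule.closed_of_finiteDimensional S.toNonUnitalSubalgebra.toSubmodule
    exact NonUnitalStarAlgebra.elemental.le_of_mem hcl hbS (cfcₙ_mem_elemental f b)
  · rw [IsIdempotentElem, ← cfcₙ_mul _ _ _ (hc _) hf0 (hc _) hf0]
    congr 1
    ext z
    by_cases hz : z = μ <;> simp [f, hz]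
  · intro h0
    have h1 := cfcₙ_map_quasispectrum f b (hc _) hf0
    rw [h0] at h1
    have h2 : (1 : ℂ) ∈ f '' quasispectrum ℂ b := ⟨μ, hμq, if_pos rfl⟩
    rw [← h1, quasispectrum_eq_spectrum_union_zero, spectrum.zero_eq] at h2
    simp at h2
  · have hid := cfcₙ_mul f (fun z : ℂ => z) b (hc _) hf0 (hc _) rfl
    rw [cfcₙ_id' ℂ b] at hid
    rw [← hid, ← cfcₙ_const_mul _ _ _ (hc _) hf0]
    congr 1
    ext z
    by_cases hz : z = μ <;> simp [f, hz]

/-- A nonzero finite-dimensional `*`-algebra of operators has a minimal projection. -/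
theorem NonUnitalStarSubalgebra.exists_minimal_projection (S : NonUnitalStarSubalgebra ℂ B)
    [FiniteDimensional ℂ S] {x : B} (hx : x ∈ S) (hx0 : x ≠ 0) :
    ∃ p ∈ S, IsStarProjection p ∧ p ≠ 0 ∧ ∀ b ∈ S, ∃ c : ℂ, p * b * p = c • p := by
  let S' := S.toNonUnitalSubalgebra.toSubmodule
  let V : B → Submodule ℂ B := fun p =>
    S'.map (LinearMap.mulLeft ℂ p ∘ₗ LinearMap.mulRight ℂ p)
  let P : Set B := {p | p ∈ S ∧ IsStarProjection p ∧ p ≠ 0}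
  have hP : P.Nonempty := by
    obtain ⟨q, hq, hq', hq0, -⟩ := S.exists_spectral_projection (IsSelfAdjoint.star_mul_self x)
      (mul_mem (s := S) (star_mem hx) hx) (by simpa using hx0)
    exact ⟨q, hq, hq', hq0⟩
  -- Minimise `dim p S p`. A spectral projection `q` of `p b p` lies below `p`, so minimality forces
  -- `q S q = p S p`, hence `q = p` and `p b p = μ p`.
  obtain ⟨p, ⟨hp, hpp, hp0⟩, hmin⟩ :
      ∃ p ∈ P, ∀ q ∈ P, Module.finrank ℂ (V p) ≤ Module.finrank ℂ (V q) :=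
    ⟨_, Function.argminOn_mem (fun p => Module.finrank ℂ (V p)) P hP,
      fun q hq => Function.argminOn_le (fun p => Module.finrank ℂ (V p)) P hq⟩
  have hpi : p * p = p := hpp.isIdempotentElem
  have hps : star p = p := hpp.isSelfAdjoint
  have key : ∀ b ∈ S, IsSelfAdjoint b → ∃ c : ℂ, p * b * p = c • p := by
    intro b hb hbsa
    by_cases h0 : p * b * p = 0
    · exact ⟨0, by rw [h0, zero_smul]⟩
    have hsa : IsSelfAdjoint (p * b * p) := by
      rw [IsSelfAdjoint, star_mul, star_mul, hps, hbsa.star_eq, mul_assoc]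
    obtain ⟨q, hq, hqq, hq0, μ, hμ, h1, h2⟩ :=
      S.exists_spectral_projection hsa (S.mul_mem (S.mul_mem hp hb) hp) h0
    have hpq : p * q = q := by
      have : p * (μ • q) = μ • q := by
        rw [← h1, ← mul_assoc, ← mul_assoc, ← mul_assoc, hpi]
      rw [mul_smul_comm] at this
      exact smul_right_injective _ hμ this
    have hqp : q * p = q := by
      have : (μ • q) * p = μ • q := by
        rw [← h2, mul_assoc, mul_assoc (p * b), hpi]
      rw [smul_mul_assoc] at this
      exact smul_right_injective _ hμ this
    have hle : V q ≤ V p := by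
      rintro _ ⟨y, hy, rfl⟩
      refine ⟨q * (y * q), S.mul_mem hq (S.mul_mem hy hq), ?_⟩
      simp only [LinearMap.comp_apply, LinearMap.mulLeft_apply, LinearMap.mulRight_apply]
      rw [mul_assoc q (y * q) p, mul_assoc y q p, hqp, ← mul_assoc p, hpq]
    have hfd : FiniteDimensional ℂ S' := inferInstanceAs (FiniteDimensional ℂ S)
    have heq : V q = V p := Submodule.eq_of_le_of_finrank_le hle (hmin q ⟨hq, hqq, hq0⟩)
    have hpV : p ∈ V q := by
      rw [heq]
      exact ⟨p, hp, by simp [hpi]⟩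
    obtain ⟨y, -, hy⟩ := hpV
    simp only [LinearMap.comp_apply, LinearMap.mulLeft_apply, LinearMap.mulRight_apply] at hy
    have hqp' : q = p := by
      rw [← hqp, ← hy, ← mul_assoc, hqq.isIdempotentElem]
    refine ⟨μ, ?_⟩
    rw [← hqp', ← h1, hqp', mul_assoc (p * b), hpi]
  refine ⟨p, hp, hpp, hp0, fun b hb => ?_⟩
  obtain ⟨c₁, h₁⟩ := key (b + star b)
    (add_mem (s := S) hb (star_mem hb)) (IsSelfAdjoint.add_star_self b)
  obtain ⟨c₂, h₂⟩ := key (Complex.I • (b - star b))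
    (SMulMemClass.smul_mem (s := S) _ (sub_mem (H := S) hb (star_mem hb))) (by
      rw [IsSelfAdjoint, star_smul, star_sub, star_star, Complex.star_def, Complex.conj_I, neg_smul,
        ← smul_neg, neg_sub])
  refine ⟨(1 / 2 : ℂ) * (c₁ - Complex.I * c₂), ?_⟩
  rw [mul_smul_comm, smul_mul_assoc] at h₂
  have h₃ : p * (b - star b) * p = (-Complex.I * c₂) • p := by
    rw [mul_smul, ← h₂, smul_smul]
    simp
  have : b = (1 / 2 : ℂ) • ((b + star b) + (b - star b)) := by
    rw [add_add_sub_cancel, ← two_smul ℂ b, smul_smul]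
    norm_num
  conv_lhs => rw [this]
  rw [mul_smul_comm, smul_mul_assoc, mul_add, add_mul, h₁, h₃, ← add_smul, smul_smul]
  ring_nf

/-- A finite-dimensional space of operators stable under the products `x y` and `x* y` contains a
projection that is minimal with respect to all left multipliers of the space. -/
theorem Submodule.exists_minimal_projection (X : Submodule ℂ B) [FiniteDimensional ℂ X]
    (hX : X ≠ ⊥) (hmul : ∀ x ∈ X, ∀ y ∈ X, x * y ∈ X) (hstar : ∀ x ∈ X, ∀ y ∈ X, star x * y ∈ X) :
    ∃ p ∈ X, IsStarProjection p ∧ p ≠ 0 ∧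
      ∀ b, (∀ x ∈ X, b * x ∈ X) → ∃ c : ℂ, p * b * p = c • p := by
  -- `X` need not be closed under adjoints; the span of the products `x* y` is, and it stays inside
  -- `X`.
  let Y : Submodule ℂ B := Submodule.span ℂ (Set.image2 (fun x y => star x * y) X X)
  have hYX : Y ≤ X := by
    refine Submodule.span_le.2 ?_
    rintro _ ⟨x, hx, y, hy, rfl⟩
    exact hstar x hx y hy
  have hYstar : ∀ y ∈ Y, star y ∈ Y := by
    intro y hy
    induction hy using Submodule.span_induction with
    | mem y h =>
      obtain ⟨a, ha, b, hb, rfl⟩ := h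
      rw [star_mul, star_star]
      exact Submodule.subset_span ⟨b, hb, a, ha, rfl⟩
    | zero => simp
    | add x y _ _ hx hy => rw [star_add]; exact add_mem hx hy
    | smul c x _ hx => rw [star_smul]; exact Submodule.smul_mem _ _ hx
  have hYmul : ∀ x ∈ Y, ∀ y ∈ X, x * y ∈ Y := by
    intro x hx y hy
    induction hx using Submodule.span_induction with
    | mem x h =>
      obtain ⟨a, ha, b, hb, rfl⟩ := h
      exact Submodule.subset_span ⟨a, ha, b * y, hmul b hb y hy, (mul_assoc _ _ _).symm⟩
    | zero => simp
    | add x y _ _ hx hy => rw [add_mul]; exact add_mem hx hy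
    | smul c x _ hx => rw [smul_mul_assoc]; exact Submodule.smul_mem _ _ hx
  let S : NonUnitalStarSubalgebra ℂ B :=
    { carrier := Y
      add_mem' := fun hx hy => Y.add_mem hx hy
      zero_mem' := Y.zero_mem
      smul_mem' := fun c _ hx => Y.smul_mem c hx
      mul_mem' := fun {x y} hx hy => hYmul x hx y (hYX hy)
      star_mem' := fun {y} hy => hYstar y hy }
  have hY : FiniteDimensional ℂ Y := Submodule.finiteDimensional_of_le hYX
  have hS : FiniteDimensional ℂ S := hY
  obtain ⟨x, hx, hx0⟩ := Submodule.exists_mem_ne_zero_of_ne_bot hX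
  obtain ⟨p, hp, hpp, hp0, h⟩ := S.exists_minimal_projection (x := star x * x)
    (Submodule.subset_span ⟨x, hx, x, hx, rfl⟩) (by simpa using hx0)
  refine ⟨p, hYX hp, hpp, hp0, fun b hb => ?_⟩
  -- A multiplier `b` may lie outside `Y`, but `p b p` does not change when `b` is replaced by `p b
  -- p`, which is in `Y`.
  obtain ⟨c, hc⟩ := h (p * (b * p)) (hYmul p hp _ (hb p (hYX hp)))
  have hpi : p * p = p := hpp.isIdempotentElem
  refine ⟨c, ?_⟩
  rw [← hc, ← mul_assoc p p, hpi, mul_assoc p, mul_assoc p, mul_assoc b, hpi]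

end MinimalProjections

/-! ### Abelian projections and type I. -/

section TypeOne

variable {E : Type w} [NormedAddCommGroup E] [InnerProductSpace ℂ E] [CompleteSpace E]

theorem mem_generatedVonNeumann_iff {s : Set (E →L[ℂ] E)} {z : E →L[ℂ] E} :
    z ∈ generatedVonNeumann s ↔
      z ∈ StarSubalgebra.centralizer ℂ (StarSubalgebra.centralizer ℂ s : Set (E →L[ℂ] E)) :=
  Iff.rfl

theorem subset_generatedVonNeumann (s : Set (E →L[ℂ] E)) : s ⊆ generatedVonNeumann s := by
  intro z hz
  rw [SetLike.mem_coe, mem_generatedVonNeumann_iff, StarSubalgebra.mem_centralizer_iff]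
  intro g hg
  have h1 := (StarSubalgebra.mem_centralizer_iff ℂ).1 hg z hz
  have h2 := (StarSubalgebra.mem_centralizer_iff ℂ).1 (star_mem hg) z hz
  exact ⟨h1.1.symm, h2.1.symm⟩

theorem starProjection_commute_of_invariant (K : Submodule ℂ E) [K.HasOrthogonalProjection]
    {T : E →L[ℂ] E} (h : ∀ x ∈ K, T x ∈ K) (h' : ∀ x ∈ K, star T x ∈ K) :
    T * K.starProjection = K.starProjection * T := by
  ext x
  refine (Submodule.eq_starProjection_of_mem_of_inner_eq_zero (h _ (K.starProjection_apply_mem x))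
    fun w hw => ?_).symm
  change inner ℂ (T x - T (K.starProjection x)) w = 0
  rw [← map_sub, ← ContinuousLinearMap.adjoint_inner_right]
  exact Submodule.starProjection_inner_eq_zero x _ (h' w hw)

/-- The double commutant of a `*`-algebra of operators preserves its closed invariant subspaces. -/
theorem apply_mem_of_mem_generatedVonNeumann {s : Set (E →L[ℂ] E)} {m : E →L[ℂ] E}
    (hm : m ∈ generatedVonNeumann s) (hs : ∀ T ∈ s, star T ∈ s) (K : Submodule ℂ E)
    (hK : IsClosed (K : Set E)) (h : ∀ T ∈ s, ∀ x ∈ K, T x ∈ K) {ξ : E} (hξ : ξ ∈ K) : m ξ ∈ K := by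
  have : CompleteSpace K := hK.completeSpace_coe
  have hq : K.starProjection ∈ StarSubalgebra.centralizer ℂ s := by
    rw [StarSubalgebra.mem_centralizer_iff]
    intro T hT
    refine ⟨starProjection_commute_of_invariant K (h T hT) (h _ (hs T hT)),
      starProjection_commute_of_invariant K (h _ (hs T hT)) ?_⟩
    rw [star_star]
    exact h T hT
  have h1 := ((StarSubalgebra.mem_centralizer_iff ℂ).1 (mem_generatedVonNeumann_iff.1 hm) _ hq).1
  have h2 := congr_arg (fun T : E →L[ℂ] E => T ξ) h1
  simp only [mul_apply_eq_comp] at h2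
  rw [Submodule.starProjection_eq_self_iff.2 hξ] at h2
  rw [← h2]
  exact K.starProjection_apply_mem _

/-- A projection `p` with `p A p ⊆ ℂ p` is abelian in the von Neumann algebra generated by `A`. -/
theorem commute_corner_of_generatedVonNeumann {A : Type*} [NonUnitalCStarAlgebra A]
    (π : A →⋆ₙₐ[ℂ] (E →L[ℂ] E)) {p : E →L[ℂ] E} (hp : IsStarProjection p)
    (h : ∀ a, ∃ c : ℂ, p * π a * p = c • p) {a b : E →L[ℂ] E}
    (ha : a ∈ generatedVonNeumann (Set.range π)) (hb : b ∈ generatedVonNeumann (Set.range π)) :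
    (p * a * p) * (p * b * p) = (p * b * p) * (p * a * p) := by
  have hpi : ∀ x, p (p x) = p x := fun x =>
    congr_arg (fun T : E →L[ℂ] E => T x) hp.isIdempotentElem
  -- `m` keeps `p ξ` inside its closed cyclic subspace, which `p` maps into the line `ℂ p ξ`. Every
  -- vector of the range of `p` is thus a common eigenvector of the corner, which is therefore
  -- commutative.
  have key : ∀ m ∈ generatedVonNeumann (Set.range π), ∀ ξ, ∃ c : ℂ, p (m (p ξ)) = c • p ξ := by
    intro m hm ξ
    let K₀ : Submodule ℂ E := Submodule.span ℂ (insert (p ξ) (Set.range fun a => π a (p ξ)))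
    have h1 : m (p ξ) ∈ K₀.topologicalClosure := by
      refine apply_mem_of_mem_generatedVonNeumann hm ?_ _ K₀.isClosed_topologicalClosure ?_
        (K₀.le_topologicalClosure (Submodule.subset_span (Set.mem_insert _ _)))
      · rintro _ ⟨a, rfl⟩
        exact ⟨star a, StarHomClass.map_star π a⟩
      · rintro _ ⟨a, rfl⟩ x hx
        have hmap : ∀ x ∈ K₀, π a x ∈ K₀ := by
          intro x hx
          induction hx using Submodule.span_induction with
          | mem x hx =>
            rcases hx with rfl | ⟨b, rfl⟩
            · exact Submodule.subset_span (Set.mem_insert_of_mem _ ⟨a, rfl⟩)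
            · refine Submodule.subset_span (Set.mem_insert_of_mem _ ⟨a * b, ?_⟩)
              simp only [map_mul, mul_apply_eq_comp]
          | zero => simp
          | add x y _ _ hx hy => rw [map_add]; exact add_mem hx hy
          | smul c x _ hx => rw [map_smul]; exact K₀.smul_mem _ hx
        exact map_mem_closure (π a).continuous hx hmap
    have h2 : K₀.topologicalClosure ≤
        (Submodule.span ℂ {p ξ}).comap (p : E →ₗ[ℂ] E) := by
      refine Submodule.topologicalClosure_minimal _ (Submodule.span_le.2 ?_) ?_
      · rintro x (rfl | ⟨b, rfl⟩)
        · change p (p ξ) ∈ Submodule.span ℂ {p ξ}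
          rw [hpi]
          exact Submodule.mem_span_singleton_self _
        · obtain ⟨c, hc⟩ := h b
          have := congr_arg (fun T : E →L[ℂ] E => T ξ) hc
          exact Submodule.mem_span_singleton.2 ⟨c, this.symm⟩
      · exact (Submodule.closed_of_finiteDimensional (Submodule.span ℂ {p ξ})).preimage p.continuous
    obtain ⟨c, hc⟩ := Submodule.mem_span_singleton.1 (h2 h1)
    exact ⟨c, hc.symm⟩
  ext ξ
  obtain ⟨c, hc⟩ := key a ha ξ
  obtain ⟨d, hd⟩ := key b hb ξ
  simp only [mul_apply_eq_comp, hpi, hc, hd, map_smul, smul_smul, mul_comm]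

variable {H : Type u} [Ring H] [HopfAlgebra ℂ H] [StarRing H] {φ : H →ₗ[ℂ] ℂ}

theorem IsNormalizedIntegral.isTypeICStar (hφ : IsNormalizedIntegral φ)
    (hH : IsCompactHopfStarAlgebra H) : IsTypeICStar.{u, w} (HCStar φ) := by
  intro E _ _ _ π z hz hz' hzp hz0
  have hzi : z * z = z := hzp.isIdempotentElem
  have hcomm : ∀ m ∈ generatedVonNeumann (Set.range π), m * z = z * m :=
    VonNeumannAlgebra.mem_commutant_iff.1 hz'
  have hπM : ∀ a, π a ∈ generatedVonNeumann (Set.range π) := fun a =>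
    subset_generatedVonNeumann _ ⟨a, rfl⟩
  have hcont : Continuous π := continuous_representation π
  suffices ∃ p ∈ generatedVonNeumann (Set.range π), IsStarProjection p ∧ p ≠ 0 ∧ z * p = p ∧
      ∀ f, ∃ c : ℂ, p * π (hφ.embedding hH f) * p = c • p by
    obtain ⟨p, hpM, hp, hp0, hzp, h⟩ := this
    refine ⟨p, hpM, hp, hp0, hzp, fun a ha b hb =>
      commute_corner_of_generatedVonNeumann π hp (fun a => ?_) ha hb⟩
    have : p * π a * p ∈ Submodule.span ℂ {p} :=
      (hφ.denseRange_embedding hH).induction_on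
        (p := fun a => p * π a * p ∈ Submodule.span ℂ {p}) a
        ((Submodule.closed_of_finiteDimensional (Submodule.span ℂ {p})).preimage (by fun_prop))
        fun f => by
          obtain ⟨c, hc⟩ := h f
          exact Submodule.mem_span_singleton.2 ⟨c, hc.symm⟩
    obtain ⟨c, hc⟩ := Submodule.mem_span_singleton.1 this
    exact ⟨c, hc.symm⟩
  -- In the degenerate case all `z π(a) z` vanish and `z` is already abelian.
  by_cases h0 : ∀ f, z * π (hφ.embedding hH f) = 0
  · exact ⟨z, hz, hzp, hz0, hzi, fun f => ⟨0, by rw [h0, zero_mul, zero_smul]⟩⟩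
  push Not at h0
  obtain ⟨f, hf⟩ := h0
  obtain ⟨C, hC, hfC, hmul⟩ := hφ.exists_finiteDimensional_leftIdeal hH f
  let L : ConvAlg φ →ₗ[ℂ] (E →L[ℂ] E) :=
    { toFun := fun c => z * π (hφ.embedding hH c)
      map_add' := fun x y => by simp [mul_add]
      map_smul' := fun c x => by simp }
  have hL : ∀ g c, π (hφ.embedding hH g) * L c = L (g * c) := fun g c => by
    simp only [L, LinearMap.coe_mk, AddHom.coe_mk, map_mul]
    rw [← mul_assoc, hcomm _ (hπM _), mul_assoc]
  have hzL : ∀ c, z * L c = L c := fun c => by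
    simp only [L, LinearMap.coe_mk, AddHom.coe_mk, ← mul_assoc, hzi]
  have hLmul : ∀ g c, L g * L c = L (g * c) := fun g c => by
    rw [← hzL (g * c), ← hL, ← mul_assoc]
    rfl
  have hLstar : ∀ g, star (L g) = L (star g) := fun g => by
    simp only [L, LinearMap.coe_mk, AddHom.coe_mk, star_mul, hzp.isSelfAdjoint.star_eq,
      StarHomClass.map_star]
    rw [← StarHomClass.map_star, hcomm _ (hπM _)]
  -- Stability under `x* y` holds because `C` is a left ideal, although it need not be closed under
  -- `⋆`. The multipliers needed afterwards are the `π(g)`.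
  obtain ⟨p, hpX, hp, hp0, h⟩ := Submodule.exists_minimal_projection (C.map L) (by
      rw [Submodule.ne_bot_iff]
      exact ⟨L f, ⟨f, hfC, rfl⟩, hf⟩) (by
      rintro _ ⟨x, hx, rfl⟩ _ ⟨y, hy, rfl⟩
      exact ⟨x * y, hmul x y hy, (hLmul x y).symm⟩) (by
      rintro _ ⟨x, hx, rfl⟩ _ ⟨y, hy, rfl⟩
      rw [hLstar]
      exact ⟨star x * y, hmul _ y hy, (hLmul _ y).symm⟩)
  obtain ⟨c, hc, rfl⟩ := hpX
  refine ⟨L c, mul_mem hz (hπM _), hp, hp0, hzL c, fun g => h _ ?_⟩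
  rintro _ ⟨x, hx, rfl⟩
  exact ⟨g * x, hmul g x hx, (hL g x).symm⟩

end TypeOne

end

theorem mainTheorem8 {H : Type u} [Ring H] [HopfAlgebra ℂ H] [StarRing H] [StarModule ℂ H]
    (hH : IsCompactHopfStarAlgebra H) (φ : H →ₗ[ℂ] ℂ) (hφ : IsNormalizedIntegral φ) :
    ∃ j : ConvAlg φ →⋆ₙₐ[ℂ] HCStar φ,
      -- `HCStar φ` is the completion of the convolution algebra for the norm `cstarNorm φ`
      (∀ f l, (j f : BoundedFamilies φ).component l = l.op f) ∧
      (∀ f, BddAbove (Set.range fun l : SimpleStarModule φ => ‖l.op f‖)) ∧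
      (∀ f, ‖j f‖ = cstarNorm φ f) ∧
      Function.Injective j ∧
      DenseRange j ∧
      -- all irreducible unitary representations are finite-dimensional
      (∀ ρ : IrredUnitaryRep.{u, w} (HCStar φ), FiniteDimensional ℂ ρ.space) ∧
      (∀ σ : IrredUnitaryRep.{u, w} (ConvAlg φ), FiniteDimensional ℂ σ.space) ∧
      -- restriction along `j` is a bijection between the two sets of equivalence classes
      (∃ e : IrredClasses.{u, w} (HCStar φ) ≃ IrredClasses.{u, w} (ConvAlg φ),
        ∀ (ρ : IrredUnitaryRep.{u, w} (HCStar φ)) (σ : IrredUnitaryRep.{u, w} (ConvAlg φ)),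
          e (Quotient.mk _ ρ) = Quotient.mk _ σ ↔
            ∃ U : ρ.space ≃ₗᵢ[ℂ] σ.space, ∀ f v, U (ρ.hom (j f) v) = σ.hom f (U v)) ∧
      IsTypeICStar.{u, w} (HCStar φ) := by
  refine ⟨hφ.embedding hH, hφ.component_embedding hH, hφ.bddAbove_norm_op hH,
    hφ.norm_embedding hH, hφ.embedding_injective hH, hφ.denseRange_embedding hH,
    fun ρ => (ρ.restrict hφ hH).finiteDimensional hφ hH, fun σ => σ.finiteDimensional hφ hH,
    hφ.exists_irredClasses_equiv hH, hφ.isTypeICStar hH⟩
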